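/- **Setting.** Let $\Omega\subset\mathbb R^2$ be a bounded domain with $\operatorname{int}\overline\Omega=\Omega$ and boundary $\Gamma$, whose closure is the union of the triangles $K_1,\dots,K_M$ of a conforming triangulation (nondegenerate closed triangles with pairwise disjoint interiors, two distinct ones meeting in a common edge, in a common vertex, or not at all). Let $q\ge 2$ be an integer, and let $\mathcal H_h$ be the space of all $z\in H^1(\Omega)$ that are polynomials of degree at most $q+1$ on each $K_i$ and whose gradient has zero normal jump: $\nabla z|_{K_i}\cdot n_i+\nabla z|_{K_j}\cdot n_j=0$ on every common edge of two triangles, and $\nabla z|_{K_i}\cdot n_i=0$ on every edge of $K_i$ contained in $\Gamma$ ($n_i$ is the outward unit normal of $K_i$). Let $\bar M_q=\dim\mathcal H_h$, let $(\cdot,\cdot)$ and $\|\cdot\|$ be the inner product and the norm of $L^2(\Omega)$, let $p_h$ be the $L^2$-projection onto $\mathcal H_h$, and let $\phi_1,\dots,\phi_{\bar M_q}$ be an $L^2$-orthonormal basis of $\mathcal H_h$ of eigenvectors of the stiffness operator: $\int_\Omega\nabla\phi_j\cdot\nabla z=\lambda_j(\phi_j,z)$ for all $z\in\mathcal H_h$.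 Let $\alpha_1,\alpha_2,\beta_0>0$, $\beta_0+k_0>0$, $T>0$, $u_0,v_0,u_1,v_1\in L^2(\Omega)$, and put $F_1(u,v)=\beta_0(1-u)-uv^2$, $F_2(u,v)=-(\beta_0+k_0)v+uv^2$. For $N\ge1$ and $\sigma=T/N$, a numerical solution is a family $u_h^s=\sum_j u_{h,j}^s\phi_j$, $v_h^s=\sum_j v_{h,j}^s\phi_j$, $s=0,\frac12,1,\dots,N$, such that for $w\in\{u,v\}$, with $(\alpha,F,w_0,w_1)=(\alpha_1,F_1,u_0,u_1)$ for $w=u$ and $(\alpha_2,F_2,v_0,v_1)$ for $w=v$, and with $F^s=F(u_h^s,v_h^s)$, one has for every $j$ * $w_{h,j}^{n+\frac12}+\frac{\alpha\lambda_j\sigma}{4}\bigl(3w_{h,j}^{n}-w_{h,j}^{n-\frac12}\bigr)=w_{h,j}^{n}+\frac\sigma4\bigl(3F^n-F^{n-\frac12},\phi_j\bigr)$ for $1\le n\le N-1$ (explicit first stage), * $w_{h,j}^{n+1}+\frac{\alpha\lambda_j\sigma}{4}\bigl(w_{h,j}^{n+1}+w_{h,j}^{n+\frac12}\bigr)=w_{h,j}^{n+\frac12}+\frac\sigma4\bigl(F^{n+1}+F^{n+\frac12},\phi_j\bigr)$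 for $0\le n\le N-1$ (implicit second stage), * $w_h^0=p_hw_0$ and $w_h^{1/2}=p_h\bigl(w_0+\frac\sigma2w_1\bigr)$, * the discrete Neumann condition $\nabla w_h^n\cdot n=0$ on $\Gamma$ for $1\le n\le N$. **Theorem 1 (strong stability).** For small time steps $\sigma$ the scheme is strongly stable, in the following sense. 1. In coordinates the two stages are the linear multistep formulas, with step $\sigma/2$, for the Galerkin system $y'=\bar F(y)$, $\bar F=\bigl(-\lambda_j\alpha_1u_{h,j}+(F_1(u_h,v_h),\phi_j),\,-\lambda_j\alpha_2v_{h,j}+(F_2(u_h,v_h),\phi_j)\bigr)_j$, whose characteristic polynomials are $\lambda^2-\lambda$ and $\lambda^3-\lambda^2$. Both formulas are strongly stable: all roots lie in the closed unit disc, those of modulus one are simple, and $1$ is the only root of modulus one. 2. For every $R$ there are $\sigma_0>0$ and $C$ such that, whenever $\sigma=T/N\le\sigma_0$, any two families satisfying all of the above conditions except possibly those on $w_h^0,w_h^{1/2}$, with $\|u_h^s\|+\|v_h^s\|\le R$ for $s=0,\frac12$ in each of the two, differ at every $s\in\{0,\frac12,1,\dots,N\}$, in the norm $\|u\|+\|v\|$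 of the difference, by at most $C$ times the larger of their differences at $s=0$ and $s=\frac12$. Furthermore, there are $\sigma_0>0$ and $C_0>0$, with $C_0$ independent of $\sigma$, such that for every $N\ge1$ with $\sigma=T/N\le\sigma_0$ a numerical solution exists, and every numerical solution satisfies $$\max_{s}\|u_h^s\|\le C_0\sqrt{\bar M_q},\qquad \max_{s}\|v_h^s\|\le C_0\sqrt{\bar M_q},\qquad s\in\{0,\tfrac12,1,\dots,N\}.$$ -/

import Mathlib

open MeasureTheory

noncomputable section

namespace GrayScottFEM

/-! ### The plane, weak gradients and the Sobolev space `H¹` -/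

/-- The Euclidean plane. -/
abbrev Plane : Type := EuclideanSpace ℝ (Fin 2)

/-- The real Hilbert space `L²(Ω)`; its inner product is `(u, v) = ∫_Ω u v`. -/
abbrev L2 (Ω : Set Plane) : Type := Lp ℝ 2 ((volume : Measure Plane).restrict Ω)

/-- The Hilbert space of square integrable vector fields on `Ω`. -/
abbrev L2Vec (Ω : Set Plane) : Type := Lp Plane 2 ((volume : Measure Plane).restrict Ω)

/-- `G` is the weak gradient of `z` on `Ω`. -/
def HasWeakGrad (Ω : Set Plane) (z : L2 Ω) (G : L2Vec Ω) : Prop :=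
  ∀ ψ : Plane → ℝ, ContDiff ℝ (⊤ : ℕ∞) ψ → HasCompactSupport ψ → tsupport ψ ⊆ Ω →
    ∀ e : Plane, ∫ x in Ω, z x * fderiv ℝ ψ x e = - ∫ x in Ω, inner ℝ (G x) e * ψ x

/-- Membership in `H¹(Ω)`. -/
def InH1 (Ω : Set Plane) (z : L2 Ω) : Prop := ∃ G : L2Vec Ω, HasWeakGrad Ω z G

open Classical in
/-- The weak gradient of a function in `H¹(Ω)`. -/
def weakGrad (Ω : Set Plane) (z : L2 Ω) : L2Vec Ω :=
  if h : InH1 Ω z then h.choose else 0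

/-- The form `(z, w)_∇ = ∫_Ω ∇z · ∇w` on `H¹(Ω)`. -/
def gradInner (Ω : Set Plane) (z w : L2 Ω) : ℝ := inner ℝ (weakGrad Ω z) (weakGrad Ω w)

/-! ### Conforming triangulations -/

/-- A conforming triangulation of the closure of `Ω` by `M` nondegenerate closed triangles: the
interiors are pairwise disjoint, and two distinct triangles meet in the convex hull of their common
vertices (so in a common edge, in a common vertex, or not at all). -/
structure Triangulation (Ω : Set Plane) (M : ℕ) where
  vert : Fin M → Fin 3 → Plane
  nondegenerate : ∀ i, AffineIndependent ℝ (vert i)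
  cover : ⋃ i, convexHull ℝ (Set.range (vert i)) = closure Ω
  interior_disjoint : ∀ i j, i ≠ j →
    Disjoint (interior (convexHull ℝ (Set.range (vert i))))
      (interior (convexHull ℝ (Set.range (vert j))))
  conforming : ∀ i j, i ≠ j →
    convexHull ℝ (Set.range (vert i)) ∩ convexHull ℝ (Set.range (vert j)) =
      convexHull ℝ (Set.range (vert i) ∩ Set.range (vert j))

namespace Triangulation

variable {Ω : Set Plane} {M : ℕ}

/-- The closed triangle `K_i`. -/
def tri (𝒯 : Triangulation Ω M) (i : Fin M) : Set Plane := convexHull ℝ (Set.range (𝒯.vert i))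

/-- The edge of `K_i` opposite to its `k`-th vertex. -/
def edge (𝒯 : Triangulation Ω M) (i : Fin M) (k : Fin 3) : Set Plane :=
  segment ℝ (𝒯.vert i (k + 1)) (𝒯.vert i (k + 2))

/-- `ν` is the unit normal, outward for `K_i`, of the edge of `K_i` opposite to vertex `k`. -/
def IsOuterNormal (𝒯 : Triangulation Ω M) (i : Fin M) (k : Fin 3) (ν : Plane) : Prop :=
  ‖ν‖ = 1 ∧ inner ℝ ν (𝒯.vert i (k + 2) - 𝒯.vert i (k + 1)) = 0 ∧
    inner ℝ ν (𝒯.vert i k - 𝒯.vert i (k + 1)) < 0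

end Triangulation

/-! ### The finite element space -/

/-- The value at `x` of a polynomial in two variables. -/
def polyEval (p : MvPolynomial (Fin 2) ℝ) (x : Plane) : ℝ := MvPolynomial.eval (fun c => x c) p

/-- The gradient at `x` of a polynomial in two variables. -/
def polyGrad (p : MvPolynomial (Fin 2) ℝ) (x : Plane) : Plane :=
  !₂[polyEval (MvPolynomial.pderiv 0 p) x, polyEval (MvPolynomial.pderiv 1 p) x]

section Space

variable {Ω : Set Plane} {M : ℕ}

/-- `z` coincides on every `K_i` with the polynomial `p i`, of degree at most `q + 1`. -/
def IsPiecewisePoly (𝒯 : Triangulation Ω M) (q : ℕ) (z : L2 Ω)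
    (p : Fin M → MvPolynomial (Fin 2) ℝ) : Prop :=
  ∀ i, (p i).totalDegree ≤ q + 1 ∧
    ∀ᵐ x ∂((volume : Measure Plane).restrict Ω), x ∈ 𝒯.tri i → z x = polyEval (p i) x

/-- The jump `∇p_i · n_i + ∇p_j · n_j` vanishes on every edge common to two triangles. -/
def NoInteriorJump (𝒯 : Triangulation Ω M) (p : Fin M → MvPolynomial (Fin 2) ℝ) : Prop :=
  ∀ i j, i ≠ j → ∀ k l, 𝒯.edge i k = 𝒯.edge j l → ∀ ν μ,
    𝒯.IsOuterNormal i k ν → 𝒯.IsOuterNormal j l μ → ∀ x ∈ 𝒯.edge i k,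
      inner ℝ (polyGrad (p i) x) ν + inner ℝ (polyGrad (p j) x) μ = 0

/-- The jump `∇p_i · n_i` vanishes on every edge in the boundary of `Ω`: this is the homogeneous
Neumann condition. -/
def NoBoundaryJump (𝒯 : Triangulation Ω M) (p : Fin M → MvPolynomial (Fin 2) ℝ) : Prop :=
  ∀ i k, 𝒯.edge i k ⊆ frontier Ω → ∀ ν, 𝒯.IsOuterNormal i k ν → ∀ x ∈ 𝒯.edge i k,
    inner ℝ (polyGrad (p i) x) ν = 0

lemma polyEval_add (p r : MvPolynomial (Fin 2) ℝ) (x : Plane) :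
    polyEval (p + r) x = polyEval p x + polyEval r x := by simp [polyEval]

lemma polyEval_smul (c : ℝ) (p : MvPolynomial (Fin 2) ℝ) (x : Plane) :
    polyEval (c • p) x = c * polyEval p x := by simp [polyEval, MvPolynomial.smul_eval]

lemma polyGrad_add (p r : MvPolynomial (Fin 2) ℝ) (x : Plane) :
    polyGrad (p + r) x = polyGrad p x + polyGrad r x := by
  ext i; fin_cases i <;> simp [polyGrad, polyEval_add]

lemma polyGrad_smul (c : ℝ) (p : MvPolynomial (Fin 2) ℝ) (x : Plane) :
    polyGrad (c • p) x = c • polyGrad p x := by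
  ext i; fin_cases i <;> simp [polyGrad, polyEval_smul]

lemma integrable_mul_test (z : L2 Ω) {g : Plane → ℝ} (hg : Continuous g)
    (hc : HasCompactSupport g) :
    Integrable (fun x => z x * g x) ((volume : Measure Plane).restrict Ω) :=
  (Lp.memLp z).integrable_mul
    ((hg.memLp_of_hasCompactSupport (p := 2) hc : MemLp g 2 (volume : Measure Plane)).restrict Ω)

lemma integrable_inner_test (G : L2Vec Ω) (e : Plane) {g : Plane → ℝ} (hg : Continuous g)
    (hc : HasCompactSupport g) :
    Integrable (fun x => inner ℝ (G x) e * g x) ((volume : Measure Plane).restrict Ω) :=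
  ((Lp.memLp G).inner_const e).integrable_mul
    ((hg.memLp_of_hasCompactSupport (p := 2) hc : MemLp g 2 (volume : Measure Plane)).restrict Ω)

lemma HasWeakGrad.add {z w : L2 Ω} {G H : L2Vec Ω} (hz : HasWeakGrad Ω z G)
    (hw : HasWeakGrad Ω w H) : HasWeakGrad Ω (z + w) (G + H) := by
  intro ψ hψ hc hs e
  have hd : Continuous fun x => fderiv ℝ ψ x e :=
    (hψ.continuous_fderiv (by simp)).clm_apply continuous_const
  have hdc : HasCompactSupport fun x => fderiv ℝ ψ x e :=
    (hc.fderiv ℝ).comp_left (g := fun L : Plane →L[ℝ] ℝ => L e) (by simp)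
  have h1 : ∫ x in Ω, (z + w : L2 Ω) x * fderiv ℝ ψ x e =
      ∫ x in Ω, (z x * fderiv ℝ ψ x e + w x * fderiv ℝ ψ x e) := by
    refine integral_congr_ae ?_
    filter_upwards [Lp.coeFn_add z w] with x hx
    rw [hx, Pi.add_apply]; ring
  have h2 : ∫ x in Ω, inner ℝ ((G + H : L2Vec Ω) x) e * ψ x =
      ∫ x in Ω, (inner ℝ (G x) e * ψ x + inner ℝ (H x) e * ψ x) := by
    refine integral_congr_ae ?_
    filter_upwards [Lp.coeFn_add G H] with x hx
    rw [hx, Pi.add_apply, inner_add_left]; ring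
  rw [h1, h2, integral_add (integrable_mul_test z hd hdc) (integrable_mul_test w hd hdc),
    integral_add (integrable_inner_test G e hψ.continuous hc)
      (integrable_inner_test H e hψ.continuous hc), hz ψ hψ hc hs e, hw ψ hψ hc hs e]
  ring

lemma HasWeakGrad.smul {z : L2 Ω} {G : L2Vec Ω} (c : ℝ) (hz : HasWeakGrad Ω z G) :
    HasWeakGrad Ω (c • z) (c • G) := by
  intro ψ hψ hc hs e
  have h1 : ∫ x in Ω, (c • z : L2 Ω) x * fderiv ℝ ψ x e =
      ∫ x in Ω, c * (z x * fderiv ℝ ψ x e) := by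
    refine integral_congr_ae ?_
    filter_upwards [Lp.coeFn_smul c z] with x hx
    rw [hx, Pi.smul_apply, smul_eq_mul]; ring
  have h2 : ∫ x in Ω, inner ℝ ((c • G : L2Vec Ω) x) e * ψ x =
      ∫ x in Ω, c * (inner ℝ (G x) e * ψ x) := by
    refine integral_congr_ae ?_
    filter_upwards [Lp.coeFn_smul c G] with x hx
    rw [hx, Pi.smul_apply, real_inner_smul_left]; ring
  rw [h1, h2, integral_const_mul, integral_const_mul, hz ψ hψ hc hs e]
  ring

/-- The finite element space `H_h`: functions in `H¹(Ω)` that are polynomials of degree at most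
`q + 1` on every triangle and whose gradient has no jump, neither across the common edges of two
triangles nor (homogeneous Neumann condition) on the boundary edges. -/
def femSpace (𝒯 : Triangulation Ω M) (q : ℕ) : Submodule ℝ (L2 Ω) where
  carrier := {z | InH1 Ω z ∧
    ∃ p, IsPiecewisePoly 𝒯 q z p ∧ NoInteriorJump 𝒯 p ∧ NoBoundaryJump 𝒯 p}
  zero_mem' := by
    refine ⟨⟨0, fun ψ _ _ _ e => ?_⟩, fun _ => 0, fun i => ⟨by simp, ?_⟩, ?_, ?_⟩
    · have h1 : ∫ x in Ω, (0 : L2 Ω) x * fderiv ℝ ψ x e = ∫ x in Ω, (0 : ℝ) := by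
        refine integral_congr_ae ?_
        filter_upwards [Lp.coeFn_zero ℝ 2 ((volume : Measure Plane).restrict Ω)] with x hx
        rw [hx]; simp
      have h2 : ∫ x in Ω, inner ℝ ((0 : L2Vec Ω) x) e * ψ x = ∫ x in Ω, (0 : ℝ) := by
        refine integral_congr_ae ?_
        filter_upwards [Lp.coeFn_zero Plane 2 ((volume : Measure Plane).restrict Ω)] with x hx
        rw [hx]; simp
      rw [h1, h2]; simp
    · filter_upwards [Lp.coeFn_zero ℝ 2 ((volume : Measure Plane).restrict Ω)] with x hx _
      rw [hx]; simp [polyEval]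
    · intro i j _ k l _ ν μ _ _ x _
      have h0 : polyGrad 0 x = 0 := by simpa using polyGrad_smul 0 0 x
      simp [h0]
    · intro i k _ ν _ x _
      have h0 : polyGrad 0 x = 0 := by simpa using polyGrad_smul 0 0 x
      simp [h0]
  add_mem' := by
    rintro z w ⟨⟨G, hG⟩, p, hp, hpi, hpb⟩ ⟨⟨H, hH⟩, r, hr, hri, hrb⟩
    refine ⟨⟨G + H, hG.add hH⟩, fun i => p i + r i, fun i => ⟨?_, ?_⟩, ?_, ?_⟩
    · exact (MvPolynomial.totalDegree_add _ _).trans (max_le (hp i).1 (hr i).1)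
    · filter_upwards [Lp.coeFn_add z w, (hp i).2, (hr i).2] with x hx h1 h2 hxi
      rw [hx, Pi.add_apply, h1 hxi, h2 hxi, polyEval_add]
    · intro i j hij k l he ν μ hν hμ x hx
      have h1 := hpi i j hij k l he ν μ hν hμ x hx
      have h2 := hri i j hij k l he ν μ hν hμ x hx
      rw [polyGrad_add, polyGrad_add, inner_add_left, inner_add_left]
      linarith
    · intro i k he ν hν x hx
      have h1 := hpb i k he ν hν x hx
      have h2 := hrb i k he ν hν x hx
      rw [polyGrad_add, inner_add_left]
      linarith
  smul_mem' := by
    rintro c z ⟨⟨G, hG⟩, p, hp, hpi, hpb⟩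
    refine ⟨⟨c • G, hG.smul c⟩, fun i => c • p i, fun i => ⟨?_, ?_⟩, ?_, ?_⟩
    · exact (MvPolynomial.totalDegree_smul_le _ _).trans (hp i).1
    · filter_upwards [Lp.coeFn_smul c z, (hp i).2] with x hx h1 hxi
      rw [hx, Pi.smul_apply, h1 hxi, polyEval_smul, smul_eq_mul]
    · intro i j hij k l he ν μ hν hμ x hx
      have h1 := hpi i j hij k l he ν μ hν hμ x hx
      rw [polyGrad_smul, polyGrad_smul, real_inner_smul_left, real_inner_smul_left, ← mul_add, h1,
        mul_zero]
    · intro i k he ν hν x hx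
      rw [polyGrad_smul, real_inner_smul_left, hpb i k he ν hν x hx, mul_zero]

/-- A spectral orthogonal basis of `H_h`: an `L²`-orthonormal basis `φ` of `H_h` formed by
eigenvectors of the stiffness operator `A`, which is given by `(A z, w) = (z, w)_∇` on `H_h`; `ev j`
is the eigenvalue of `φ j`. In particular `(φ l, φ j) = δ_{lj}` and
`(φ l, φ j)_∇ = ev j * δ_{lj}`, and the number `m` of basis vectors is the dimension of `H_h`. -/
structure SpectralBasis (𝒯 : Triangulation Ω M) (q m : ℕ) where
  φ : Fin m → L2 Ω
  ev : Fin m → ℝ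
  orthonormal : Orthonormal ℝ φ
  span_eq : Submodule.span ℝ (Set.range φ) = femSpace 𝒯 q
  eigen : ∀ j, ∀ w ∈ femSpace 𝒯 q, gradInner Ω (φ j) w = ev j * inner ℝ (φ j) w

end Space

/-! ### The two-stage explicit/implicit scheme -/

/-- The parameters of the Gray–Scott system. -/
structure Params where
  α₁ : ℝ
  α₂ : ℝ
  β₀ : ℝ
  k₀ : ℝ
  α₁_pos : 0 < α₁
  α₂_pos : 0 < α₂
  β₀_pos : 0 < β₀
  removal_pos : 0 < β₀ + k₀

/-- The reaction term of the first equation. -/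
def Params.F₁ (P : Params) (u v : ℝ) : ℝ := P.β₀ * (1 - u) - u * v ^ 2

/-- The reaction term of the second equation. -/
def Params.F₂ (P : Params) (u v : ℝ) : ℝ := -(P.β₀ + P.k₀) * v + u * v ^ 2

/-- The coordinates of a pair `(u_h, v_h)` of elements of `H_h` in a basis of `m` vectors. -/
abbrev State (m : ℕ) : Type := (Fin m → ℝ) × (Fin m → ℝ)

section Scheme

variable {Ω : Set Plane} {M q m : ℕ} {𝒯 : Triangulation Ω M}

/-- The function with coordinates `c` in the basis. -/
def SpectralBasis.fn (B : SpectralBasis 𝒯 q m) (c : Fin m → ℝ) : L2 Ω := ∑ l, c l • B.φ l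

/-- `(F₁(u_h, v_h), φ_j)`. -/
def load₁ (P : Params) (B : SpectralBasis 𝒯 q m) (s : State m) (j : Fin m) : ℝ :=
  ∫ x in Ω, P.F₁ (B.fn s.1 x) (B.fn s.2 x) * B.φ j x

/-- `(F₂(u_h, v_h), φ_j)`. -/
def load₂ (P : Params) (B : SpectralBasis 𝒯 q m) (s : State m) (j : Fin m) : ℝ :=
  ∫ x in Ω, P.F₂ (B.fn s.1 x) (B.fn s.2 x) * B.φ j x

/-- The explicit first stage with time step `σ`: from `a` at time `t_{n-1/2}` and `b` at time `t_n`
to `c` at time `t_{n+1/2}`. -/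
def FirstStage (P : Params) (B : SpectralBasis 𝒯 q m) (σ : ℝ) (a b c : State m) : Prop :=
  ∀ j,
    c.1 j + P.α₁ * B.ev j * σ / 4 * (3 * b.1 j - a.1 j) =
        b.1 j + σ / 4 * (3 * load₁ P B b j - load₁ P B a j) ∧
      c.2 j + P.α₂ * B.ev j * σ / 4 * (3 * b.2 j - a.2 j) =
        b.2 j + σ / 4 * (3 * load₂ P B b j - load₂ P B a j)

/-- The implicit second stage with time step `σ`: from `c` at time `t_{n+1/2}` to `d` at time
`t_{n+1}`. -/
def SecondStage (P : Params) (B : SpectralBasis 𝒯 q m) (σ : ℝ) (c d : State m) : Prop :=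
  ∀ j,
    d.1 j + P.α₁ * B.ev j * σ / 4 * (d.1 j + c.1 j) =
        c.1 j + σ / 4 * (load₁ P B d j + load₁ P B c j) ∧
      d.2 j + P.α₂ * B.ev j * σ / 4 * (d.2 j + c.2 j) =
        c.2 j + σ / 4 * (load₂ P B d j + load₂ P B c j)

/-- The discrete homogeneous Neumann condition for a piecewise polynomial function. -/
def IsNeumann (𝒯 : Triangulation Ω M) (q : ℕ) (z : L2 Ω) : Prop :=
  ∃ p, IsPiecewisePoly 𝒯 q z p ∧ NoBoundaryJump 𝒯 p

/-- The sequence `y` runs through the two stages of the scheme with `N` time steps of length `σ`;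
`y k` holds the coordinates of `(u_h, v_h)` at time `k σ / 2`, for `k = 0, 1, …, 2N`. -/
structure IsRun (P : Params) (B : SpectralBasis 𝒯 q m) (σ : ℝ) (N : ℕ) (y : ℕ → State m) :
    Prop where
  first : ∀ n, 1 ≤ n → n < N → FirstStage P B σ (y (2 * n - 1)) (y (2 * n)) (y (2 * n + 1))
  second : ∀ n, n < N → SecondStage P B σ (y (2 * n + 1)) (y (2 * n + 2))
  neumann : ∀ n, 1 ≤ n → n ≤ N →
    IsNeumann 𝒯 q (B.fn (y (2 * n)).1) ∧ IsNeumann 𝒯 q (B.fn (y (2 * n)).2)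

/-- `w` is the `L²`-projection of `g` onto `H_h`. -/
def IsL2Proj (𝒯 : Triangulation Ω M) (q : ℕ) (g w : L2 Ω) : Prop :=
  w ∈ femSpace 𝒯 q ∧ ∀ z ∈ femSpace 𝒯 q, inner ℝ w z = inner ℝ g z

/-- `y` is a numerical solution: a run of the scheme with the starting values `p_h u₀`, `p_h v₀` at
time `0` and `p_h (u₀ + (σ/2) u₁)`, `p_h (v₀ + (σ/2) v₁)` at time `σ / 2`. -/
structure IsNumericalSolution (P : Params) (B : SpectralBasis 𝒯 q m) (u₀ v₀ u₁ v₁ : L2 Ω)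
    (σ : ℝ) (N : ℕ) (y : ℕ → State m) : Prop where
  run : IsRun P B σ N y
  start_u : IsL2Proj 𝒯 q u₀ (B.fn (y 0).1)
  start_v : IsL2Proj 𝒯 q v₀ (B.fn (y 0).2)
  half_u : IsL2Proj 𝒯 q (u₀ + (σ / 2) • u₁) (B.fn (y 1).1)
  half_v : IsL2Proj 𝒯 q (v₀ + (σ / 2) • v₁) (B.fn (y 1).2)

end Scheme

/-! ### Strong stability -/

/-- A linear `k`-step formula `∑ a_i y_{n+i} = τ ∑ b_i f(y_{n+i})`. -/
structure LinearMultistep (k : ℕ) where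
  a : Fin (k + 1) → ℝ
  b : Fin (k + 1) → ℝ

namespace LinearMultistep

variable {k : ℕ}

/-- The consecutive values `z 0, …, z k` satisfy the formula with step `τ` for `y' = f(y)`. -/
def Step {E : Type*} [AddCommGroup E] [Module ℝ E] (L : LinearMultistep k) (τ : ℝ) (f : E → E)
    (z : Fin (k + 1) → E) : Prop :=
  ∑ i, L.a i • z i = τ • ∑ i, L.b i • f (z i)

/-- The (first) characteristic polynomial `∑ a_i λ^i`. -/
def charPoly (L : LinearMultistep k) : Polynomial ℂ :=
  ∑ i, Polynomial.C (L.a i : ℂ) * Polynomial.X ^ (i : ℕ)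

/-- The root condition: all roots lie in the closed unit disc, those on the circle are simple. -/
def RootCondition (L : LinearMultistep k) : Prop :=
  ∀ z : ℂ, L.charPoly.IsRoot z → ‖z‖ ≤ 1 ∧ (‖z‖ = 1 → L.charPoly.rootMultiplicity z = 1)

/-- Strong stability of a multistep formula: the root condition holds, and `1` is the only root of
modulus one. -/
def StronglyStable (L : LinearMultistep k) : Prop :=
  L.RootCondition ∧ ∀ z : ℂ, (L.charPoly.IsRoot z ∧ ‖z‖ = 1) ↔ z = 1

end LinearMultistep

/-- The two-step formula `y_{n+2} - y_{n+1} = τ (3 f_{n+1} - f_n) / 2`. -/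
def explicitFormula : LinearMultistep 2 where
  a := ![0, -1, 1]
  b := ![-1 / 2, 3 / 2, 0]

/-- The formula `y_{n+3} - y_{n+2} = τ (f_{n+3} + f_{n+2}) / 2`, as a three-step formula. -/
def implicitFormula : LinearMultistep 3 where
  a := ![0, 0, -1, 1]
  b := ![0, 0, 1 / 2, 1 / 2]

section Stability

variable {Ω : Set Plane} {M q m : ℕ} {𝒯 : Triangulation Ω M}

/-- The right-hand side of the Galerkin system of ordinary differential equations, in coordinates:
`-λ_j α.*w_j + (F(u_h, v_h), φ_j)`. -/
def galerkinField (P : Params) (B : SpectralBasis 𝒯 q m) (s : State m) : State m :=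
  (fun j => -(B.ev j * (P.α₁ * s.1 j)) + load₁ P B s j,
    fun j => -(B.ev j * (P.α₂ * s.2 j)) + load₂ P B s j)

/-- The distance `‖u_h - ũ_h‖ + ‖v_h - ṽ_h‖` of two discrete states. -/
def stateDist (B : SpectralBasis 𝒯 q m) (s t : State m) : ℝ :=
  ‖B.fn s.1 - B.fn t.1‖ + ‖B.fn s.2 - B.fn t.2‖

/-- Strong stability of the two-stage scheme on `[0, T]` for small time steps: its stages are
strongly stable multistep formulas, with step `σ / 2`, for the Galerkin system, and for small `σ` the
runs of the nonlinear scheme depend on their starting values in a Lipschitz way, with a constant that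
does not depend on `σ` (uniformly for starting values in bounded sets). -/
structure IsStronglyStable (P : Params) (B : SpectralBasis 𝒯 q m) (T : ℝ) : Prop where
  first_eq : ∀ (σ : ℝ) (z : Fin 3 → State m),
    FirstStage P B σ (z 0) (z 1) (z 2) ↔ explicitFormula.Step (σ / 2) (galerkinField P B) z
  second_eq : ∀ (σ : ℝ) (z : Fin 4 → State m),
    SecondStage P B σ (z 2) (z 3) ↔ implicitFormula.Step (σ / 2) (galerkinField P B) z
  first_stable : explicitFormula.StronglyStable
  second_stable : implicitFormula.StronglyStable
  dependence : ∀ R : ℝ, ∃ σ₀ > 0, ∃ C : ℝ, ∀ N : ℕ, 1 ≤ N → T / N ≤ σ₀ →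
    ∀ y y' : ℕ → State m, IsRun P B (T / N) N y → IsRun P B (T / N) N y' →
      (∀ k ≤ 1, stateDist B (y k) 0 ≤ R ∧ stateDist B (y' k) 0 ≤ R) →
      ∀ k ≤ 2 * N, stateDist B (y k) (y' k) ≤
        C * max (stateDist B (y 0) (y' 0)) (stateDist B (y 1) (y' 1))

end Stability

end GrayScottFEM

end

open GrayScottFEM

namespace GrayScottFEM

/-! ### Autocatalytic systems on a Hilbert space -/

/-! In the spectral basis the scheme alternates the trapezoidal rule and the explicit two-step rule,
with step `σ / 2 = 2h`, for an ordinary differential equation in a Euclidean space. Its cubic term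
is removed from the `u`-equation and added to the `v`-equation. Three facts prevent blow-up. Since
`∫ u²v² ≥ 0`, testing the first equation with `u` bounds `u`. The cubic term cancels in `u + v`,
which therefore obeys a linear inequality driven by `u`. And `∫ v⁴ ≥ κ‖v‖⁴` controls the solutions
of the implicit equation.

The field is only locally Lipschitz, so bounds have to precede every other estimate.
`exists_implicit_bound` bounds all solutions of one implicit step and so excludes spurious large
ones. By `Run.exists_euler_step`, a run inside a given ball makes explicit Euler steps with an error
at most 1 in the field, once `h` is small for that ball. The discrete Gronwall inequality
`le_exp_mul_of_step_le`, applied to `‖u‖²` (`norm_sq_euler_step_le`) and to `‖u + v‖`, then gives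
bounds in which the ball affects only the admissible `h`. The ball can thus be chosen from the
bounds, and induction on time closes the argument in `Run.exists_bound`.

On this ball the field is Lipschitz: existence (`exists_run`) follows by a contraction in each
implicit step, and dependence on the starting values (`Run.exists_dependence`) by Gronwall again.
The linear part, diffusion included, enters as a bounded operator, so the constants may depend on
the finite element space, but not on `σ`. -/

theorem le_exp_mul_of_step_le {x : ℕ → ℝ} {a b c h : ℝ} (ha : 0 ≤ a) (hb : 0 ≤ b) (hh : 0 ≤ h)
    (h0 : x 0 ≤ c) (hc : 0 ≤ c) {n : ℕ}
    (hx : ∀ k < n, x (k + 1) ≤ (1 + a * h) * x k + b * h) :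
    x n ≤ Real.exp (a * (n * h)) * (c + b * (n * h)) := by
  induction n with
  | zero => simpa using h0
  | succ n ih =>
    have h1 := ih fun k hk => hx k (by omega)
    have h2 := hx n (by omega)
    have h3 : 1 + a * h ≤ Real.exp (a * h) := by
      have := Real.add_one_le_exp (a * h); linarith
    have h4 : (1 : ℝ) ≤ Real.exp (a * ((n + 1 : ℕ) * h)) := Real.one_le_exp (by positivity)
    have h5 : Real.exp (a * ((n + 1 : ℕ) * h)) = Real.exp (a * h) * Real.exp (a * (n * h)) := by
      rw [← Real.exp_add]; push_cast; ring_nf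
    calc x (n + 1) ≤ (1 + a * h) * x n + b * h := h2
      _ ≤ (1 + a * h) * (Real.exp (a * (n * h)) * (c + b * (n * h))) + b * h := by gcongr
      _ ≤ Real.exp (a * h) * (Real.exp (a * (n * h)) * (c + b * (n * h))) +
          Real.exp (a * ((n + 1 : ℕ) * h)) * (b * h) := by
            gcongr ?_ + ?_
            · gcongr
            · exact le_mul_of_one_le_left (by positivity) h4
      _ = Real.exp (a * ((n + 1 : ℕ) * h)) * (c + b * ((n + 1 : ℕ) * h)) := by
            rw [h5]; push_cast; ring

/-- The data of the system `u' = b - A₁ u - T(u, v, v)`, `v' = T(u, v, v) - A₂ v`, whose cubic term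
`T(u, v, v)` is removed from the first and added to the second equation. -/
structure AutocatalyticSystem (E : Type*) [NormedAddCommGroup E] [InnerProductSpace ℝ E] where
  A₁ : E →L[ℝ] E
  A₂ : E →L[ℝ] E
  b : E
  T : E → E → E → E
  K : ℝ
  κ : ℝ
  K_nonneg : 0 ≤ K
  κ_pos : 0 < κ
  -- The next two identities are all that is needed of trilinearity and symmetry: linearity in the
  -- first slot and the difference of two squares.
  sub_left : ∀ u u' v w, T (u - u') v w = T u v w - T u' v w
  sq_sub : ∀ u v v', T u v v - T u v' v' = T u (v - v') (v + v')
  norm_le : ∀ u v w, ‖T u v w‖ ≤ K * ‖u‖ * ‖v‖ * ‖w‖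
  inner_nonneg : ∀ u v, 0 ≤ inner ℝ (T u v v) u
  coercive : ∀ v, κ * ‖v‖ ^ 4 ≤ inner ℝ (T v v v) v

namespace AutocatalyticSystem

variable {E : Type*} [NormedAddCommGroup E] [InnerProductSpace ℝ E]

/-- The right-hand side of the system. -/
def field (S : AutocatalyticSystem E) (s : E × E) : E × E :=
  (S.b - S.A₁ s.1 - S.T s.1 s.2 s.2, S.T s.1 s.2 s.2 - S.A₂ s.2)

/-- The first `n` steps of length `2 h`, alternately by the implicit trapezoidal formula and the
explicit two-step formula. -/
def Run (S : AutocatalyticSystem E) (h : ℝ) (n : ℕ) (z : ℕ → E × E) : Prop :=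
  -- An odd index is at least 1, so `k - 1` is never truncated.
  ∀ k < n, (Even k → z (k + 1) = z k + h • (S.field (z (k + 1)) + S.field (z k))) ∧
    (Odd k → z (k + 1) = z k + h • ((3 : ℝ) • S.field (z k) - S.field (z (k - 1))))

/-! ### Local Lipschitz bounds and the single step -/

variable (S : AutocatalyticSystem E)

theorem exists_lipschitz (R : ℝ) : ∃ L > 0, (∀ s t : E × E, ‖s‖ ≤ R → ‖t‖ ≤ R →
    ‖S.field s - S.field t‖ ≤ L * ‖s - t‖) ∧ ∀ s : E × E, ‖s‖ ≤ R → ‖S.field s‖ ≤ L := by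
  have hK := S.K_nonneg
  rcases lt_or_ge R 0 with hR | hR
  · refine ⟨1, one_pos, fun s t hs _ => ?_, fun s hs => ?_⟩ <;>
      linarith [norm_nonneg s]
  set a := ‖S.A₁‖ + ‖S.A₂‖ with ha
  have ha0 : 0 ≤ a := by positivity
  have hlip : ∀ s t : E × E, ‖s‖ ≤ R → ‖t‖ ≤ R →
      ‖S.field s - S.field t‖ ≤ (a + 3 * S.K * R ^ 2) * ‖s - t‖ := by
    intro s t hs ht
    have hs1 := (norm_fst_le s).trans hs
    have hs2 := (norm_snd_le s).trans hs
    have ht1 := (norm_fst_le t).trans ht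
    have ht2 := (norm_snd_le t).trans ht
    have hd1 : ‖s.1 - t.1‖ ≤ ‖s - t‖ := norm_fst_le (s - t)
    have hd2 : ‖s.2 - t.2‖ ≤ ‖s - t‖ := norm_snd_le (s - t)
    have hT : ‖S.T s.1 s.2 s.2 - S.T t.1 t.2 t.2‖ ≤ 3 * S.K * R ^ 2 * ‖s - t‖ := by
      -- Telescoping: change the first argument, then the square.
      have e : S.T s.1 s.2 s.2 - S.T t.1 t.2 t.2 =
          S.T (s.1 - t.1) s.2 s.2 + S.T t.1 (s.2 - t.2) (s.2 + t.2) := by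
        rw [S.sub_left, ← S.sq_sub]; abel
      rw [e]
      have hp : ‖s.2 + t.2‖ ≤ 2 * R := (norm_add_le _ _).trans (by linarith)
      calc _ ≤ ‖S.T (s.1 - t.1) s.2 s.2‖ + ‖S.T t.1 (s.2 - t.2) (s.2 + t.2)‖ := norm_add_le _ _
        _ ≤ S.K * ‖s.1 - t.1‖ * ‖s.2‖ * ‖s.2‖ + S.K * ‖t.1‖ * ‖s.2 - t.2‖ * ‖s.2 + t.2‖ :=
          add_le_add (S.norm_le _ _ _) (S.norm_le _ _ _)
        _ ≤ S.K * ‖s - t‖ * R * R + S.K * R * ‖s - t‖ * (2 * R) := by gcongr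
        _ = _ := by ring
    have hA1 : ‖S.A₁ (s.1 - t.1)‖ ≤ a * ‖s - t‖ :=
      (S.A₁.le_opNorm _).trans (by gcongr; simp [ha])
    have hA2 : ‖S.A₂ (s.2 - t.2)‖ ≤ a * ‖s - t‖ :=
      (S.A₂.le_opNorm _).trans (by gcongr; simp [ha])
    refine max_le ?_ ?_
    · have e : (S.field s - S.field t).1 =
          -(S.A₁ (s.1 - t.1) + (S.T s.1 s.2 s.2 - S.T t.1 t.2 t.2)) := by
        simp only [field, Prod.fst_sub, map_sub]; abel
      rw [e, norm_neg]
      exact (norm_add_le _ _).trans (by linarith)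
    · have e : (S.field s - S.field t).2 =
          (S.T s.1 s.2 s.2 - S.T t.1 t.2 t.2) - S.A₂ (s.2 - t.2) := by
        simp only [field, Prod.snd_sub, map_sub]; abel
      rw [e]
      exact (norm_sub_le _ _).trans (by linarith)
  set L₀ := a + 3 * S.K * R ^ 2
  have hL0 : 0 ≤ L₀ := by positivity
  -- One constant serves both claims: it exceeds the Lipschitz constant `L₀` and the bound `L₀ * R +
  -- ‖S.field 0‖` of the field; the 1 makes it positive.
  refine ⟨L₀ + L₀ * R + ‖S.field 0‖ + 1, by positivity, fun s t hs ht => ?_, fun s hs => ?_⟩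
  · refine (hlip s t hs ht).trans ?_
    gcongr
    have : 0 ≤ L₀ * R + ‖S.field 0‖ := by positivity
    linarith
  · have h1 := hlip s 0 hs (by simpa using hR)
    have h2 : ‖S.field s‖ ≤ ‖S.field s - S.field 0‖ + ‖S.field 0‖ := by
      simpa using norm_add_le (S.field s - S.field 0) (S.field 0)
    rw [sub_zero] at h1
    have h3 : L₀ * ‖s‖ ≤ L₀ * R := by gcongr
    linarith

/-- Every solution of a small implicit step from a bounded set is bounded. -/
theorem exists_implicit_bound (R : ℝ) : ∃ R' ≥ R, ∃ h₀ > 0, ∀ h : ℝ, 0 < h → h ≤ h₀ →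
    ∀ c d : E × E, ‖c‖ ≤ R → d = c + h • (S.field d + S.field c) → ‖d‖ ≤ R' := by
  obtain ⟨L, hL, -, hLb⟩ := S.exists_lipschitz R
  have hK := S.K_nonneg
  have hκ := S.κ_pos
  set a := ‖S.A₁‖ + ‖S.A₂‖ with ha
  have ha0 : 0 ≤ a := by positivity
  set G := |R| + L with hG
  have hG0 : 0 ≤ G := by positivity
  set G' := 2 * (2 * G + ‖S.b‖) with hG'
  have hG'0 : 0 ≤ G' := by positivity
  -- Beyond the second summand the quartic term beats the cubic interaction with `u + v`; the first
  -- is the bound for `‖v‖` that remains when the reaction no longer helps `v` to grow.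
  set V₀ := 2 * G + 2 * S.K * G' / S.κ with hV₀
  have hV₀0 : 0 ≤ V₀ := by positivity
  refine ⟨|R| + G' + 3 * V₀, by linarith [le_abs_self R],
    min 1 (min (1 / (2 * (a + 1))) (S.κ / (8 * (S.K + 1) * (a + 1)))), by positivity, ?_⟩
  intro h h0 hh c d hc hd
  have hh1 : h ≤ 1 := hh.trans (min_le_left _ _)
  have hh2 : h * a ≤ 1 / 2 := by
    have := hh.trans ((min_le_right _ _).trans (min_le_left _ _))
    rw [le_div_iff₀ (by positivity)] at this
    nlinarith
  have hh3 : 4 * S.K * (h * a) ≤ S.κ / 2 := by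
    have := hh.trans ((min_le_right _ _).trans (min_le_right _ _))
    rw [le_div_iff₀ (by positivity)] at this
    have h4 : S.K * a ≤ (S.K + 1) * (a + 1) := by gcongr <;> linarith
    nlinarith
  obtain ⟨u, v⟩ := d
  set g := c + h • S.field c with hg
  have hgG : ‖g‖ ≤ G := by
    calc ‖g‖ ≤ ‖c‖ + ‖h • S.field c‖ := norm_add_le _ _
      _ ≤ |R| + 1 * L := by
        rw [norm_smul, Real.norm_of_nonneg h0.le]
        exact add_le_add (hc.trans (le_abs_self R)) (by gcongr; exact hLb c hc)
      _ = G := by rw [hG, one_mul]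
  have hg1 := (norm_fst_le g).trans hgG
  have hg2 := (norm_snd_le g).trans hgG
  have hd' : (u, v) = g + h • S.field (u, v) := by
    conv_lhs => rw [hd]
    rw [hg, smul_add]; abel
  have hu : u = g.1 + h • (S.b - S.A₁ u - S.T u v v) := congrArg Prod.fst hd'
  have hv : v = g.2 + h • (S.T u v v - S.A₂ v) := congrArg Prod.snd hd'
  have hA1 : ‖S.A₁ u‖ ≤ a * ‖u‖ := (S.A₁.le_opNorm _).trans (by gcongr; simp [ha])
  have hA2 : ‖S.A₂ v‖ ≤ a * ‖v‖ := (S.A₂.le_opNorm _).trans (by gcongr; simp [ha])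
  -- The cubic terms cancel in the sum, so `u + v` is bounded up to a small multiple of `‖v‖`.
  have hw : u + v = g.1 + g.2 + h • (S.b - S.A₁ u - S.A₂ v) := by
    calc u + v = (g.1 + h • (S.b - S.A₁ u - S.T u v v)) + (g.2 + h • (S.T u v v - S.A₂ v)) :=
          congrArg₂ (· + ·) hu hv
      _ = _ := by module
  have hun : ‖u‖ ≤ ‖u + v‖ + ‖v‖ := by simpa using norm_sub_le (u + v) v
  have hwn : ‖u + v‖ ≤ G' + 4 * (h * a) * ‖v‖ := by
    have h1 : ‖u + v‖ ≤ 2 * G + h * (‖S.b‖ + a * ‖u‖ + a * ‖v‖) := by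
      conv_lhs => rw [hw]
      calc _ ≤ ‖g.1‖ + ‖g.2‖ + ‖h • (S.b - S.A₁ u - S.A₂ v)‖ := norm_add₃_le
        _ ≤ G + G + h * (‖S.b‖ + a * ‖u‖ + a * ‖v‖) := by
          rw [norm_smul, Real.norm_of_nonneg h0.le]
          gcongr
          exact (norm_sub_le _ _).trans (add_le_add ((norm_sub_le _ _).trans (by gcongr)) hA2)
        _ = _ := by ring
    have h2 : h * ‖S.b‖ ≤ ‖S.b‖ := mul_le_of_le_one_left (norm_nonneg _) hh1
    have h3 : h * a * ‖u‖ ≤ h * a * (‖u + v‖ + ‖v‖) := by gcongr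
    have h4 : h * a * ‖u + v‖ ≤ 1 / 2 * ‖u + v‖ := by gcongr
    linarith
  have hvn : ‖v‖ ≤ V₀ := by
    by_contra! hlt
    have hV : 0 < ‖v‖ := hV₀0.trans_lt hlt
    -- Writing `u = (u + v) - v` bounds the left side by `K‖u + v‖‖v‖³ - κ‖v‖⁴`. For `‖v‖ > V₀` and
    -- small `h` this is nonpositive, and testing the second equation with `v` gives `‖v‖ ≤ 2 * G`,
    -- a contradiction.
    have hT : inner ℝ (S.T u v v) v ≤ 0 := by
      have e : S.T u v v = S.T (u + v) v v - S.T v v v := by rw [← S.sub_left]; simp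
      have h1 : inner ℝ (S.T (u + v) v v) v ≤ S.K * ‖u + v‖ * ‖v‖ * ‖v‖ * ‖v‖ :=
        (real_inner_le_norm _ _).trans (by gcongr; exact S.norm_le _ _ _)
      have h2 := S.coercive v
      have h3 : S.K * ‖u + v‖ * ‖v‖ * ‖v‖ * ‖v‖ ≤
          S.K * (G' + 4 * (h * a) * ‖v‖) * ‖v‖ * ‖v‖ * ‖v‖ := by gcongr
      have h4 : S.K * G' ≤ S.κ / 2 * ‖v‖ := by
        have : 2 * S.K * G' / S.κ ≤ ‖v‖ := by linarith
        rw [div_le_iff₀ hκ] at this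
        linarith
      rw [e, inner_sub_left]
      have h5 : S.K * (G' + 4 * (h * a) * ‖v‖) ≤ S.κ * ‖v‖ := by
        have : 4 * S.K * (h * a) * ‖v‖ ≤ S.κ / 2 * ‖v‖ := by gcongr
        linarith
      have h6 : S.K * (G' + 4 * (h * a) * ‖v‖) * ‖v‖ * ‖v‖ * ‖v‖ ≤
          S.κ * ‖v‖ * ‖v‖ * ‖v‖ * ‖v‖ := by gcongr
      have h7 : S.κ * ‖v‖ * ‖v‖ * ‖v‖ * ‖v‖ = S.κ * ‖v‖ ^ 4 := by ring
      linarith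
    have h1 : ‖v‖ ^ 2 = inner ℝ g.2 v + h * (inner ℝ (S.T u v v) v - inner ℝ (S.A₂ v) v) := by
      rw [← real_inner_self_eq_norm_sq, ← inner_sub_left, ← real_inner_smul_left,
        ← inner_add_left]
      exact congrArg (inner ℝ · v) hv
    have h2 : inner ℝ g.2 v ≤ G * ‖v‖ := (real_inner_le_norm _ _).trans (by gcongr)
    have h3 : -inner ℝ (S.A₂ v) v ≤ a * ‖v‖ * ‖v‖ := by
      rw [← inner_neg_left]
      exact (real_inner_le_norm _ _).trans (by rw [norm_neg]; gcongr)
    have h4 : h * (inner ℝ (S.T u v v) v - inner ℝ (S.A₂ v) v) ≤ h * (a * ‖v‖ * ‖v‖) :=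
      mul_le_mul_of_nonneg_left (by linarith) h0.le
    have h5 : h * a * (‖v‖ * ‖v‖) ≤ 1 / 2 * (‖v‖ * ‖v‖) := by gcongr
    have h6 : ‖v‖ * ‖v‖ ≤ 2 * G * ‖v‖ := by
      have : h * inner ℝ (S.T u v v) v ≤ 0 := mul_nonpos_of_nonneg_of_nonpos h0.le hT
      have : ‖v‖ * ‖v‖ = ‖v‖ ^ 2 := (sq _).symm
      linarith
    have h7 := le_of_mul_le_mul_right h6 hV
    have h8 : 0 ≤ 2 * S.K * G' / S.κ := by positivity
    linarith
  have hw2 : ‖u + v‖ ≤ G' + 2 * V₀ := by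
    have : 4 * (h * a) * ‖v‖ ≤ 4 * (1 / 2) * V₀ := by gcongr
    linarith
  have hR := abs_nonneg R
  exact max_le (by simpa using (by linarith : ‖u‖ ≤ |R| + G' + 3 * V₀))
    (by simpa using (by linarith : ‖v‖ ≤ |R| + G' + 3 * V₀))

/-- A small implicit step from a bounded set is solvable. -/
theorem exists_implicit_step [CompleteSpace E] (R : ℝ) : ∃ h₀ > 0, ∀ h : ℝ, 0 < h → h ≤ h₀ →
    ∀ c : E × E, ‖c‖ ≤ R → ∃ d : E × E, d = c + h • (S.field d + S.field c) := by
  obtain ⟨L, hL, hLl, hLb⟩ := S.exists_lipschitz (R + 1)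
  refine ⟨1 / (2 * L), by positivity, fun h h0 hh c hc => ?_⟩
  rw [le_div_iff₀ (by positivity)] at hh
  -- For `h * L ≤ 1 / 2` this map sends the ball of radius `R + 1` into itself and contracts by the
  -- factor 1/2.
  set Φ : E × E → E × E := fun d => c + h • (S.field d + S.field c)
  have hmaps : Set.MapsTo Φ (Metric.closedBall 0 (R + 1)) (Metric.closedBall 0 (R + 1)) := by
    intro d hd
    rw [mem_closedBall_zero_iff] at hd ⊢
    calc ‖Φ d‖ ≤ ‖c‖ + ‖h • (S.field d + S.field c)‖ := norm_add_le _ _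
      _ ≤ R + h * (L + L) := by
        rw [norm_smul, Real.norm_of_nonneg h0.le]
        gcongr
        exact (norm_add_le _ _).trans (add_le_add (hLb d hd) (hLb c (by linarith)))
      _ ≤ R + 1 := by linarith
  have hcon : ContractingWith (1 / 2) (hmaps.restrict Φ _ _) := by
    refine ⟨by rw [← NNReal.coe_lt_coe]; norm_num, LipschitzWith.of_dist_le_mul fun x y => ?_⟩
    rw [Subtype.dist_eq, Subtype.dist_eq, dist_eq_norm, dist_eq_norm]
    have hx := mem_closedBall_zero_iff.1 x.2
    have hy := mem_closedBall_zero_iff.1 y.2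
    have e : Φ x - Φ y = h • (S.field x - S.field y) := by
      simp only [Φ, smul_add, smul_sub]; abel
    change ‖Φ x - Φ y‖ ≤ _
    rw [e, norm_smul, Real.norm_of_nonneg h0.le]
    calc h * ‖S.field x - S.field y‖ ≤ h * (L * ‖(x : E × E) - y‖) := by
          gcongr; exact hLl _ _ hx hy
      _ = h * L * ‖(x : E × E) - y‖ := by ring
      _ ≤ _ := by
        gcongr
        simp only [NNReal.coe_div, NNReal.coe_one, NNReal.coe_ofNat]
        linarith
  obtain ⟨d, -, hd, -⟩ := hcon.exists_fixedPoint' Metric.isClosed_closedBall.isComplete hmaps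
    (x := c) (mem_closedBall_zero_iff.2 (by linarith)) (edist_ne_top _ _)
  exact ⟨d, hd.symm⟩

/-- As long as a run stays bounded, its steps are small perturbations of explicit Euler steps. -/
theorem Run.exists_euler_step (R : ℝ) : ∃ R' ≥ R, ∃ h₀ > 0, ∀ h, 0 < h → h ≤ h₀ →
    ∀ n z, S.Run h n z → ∀ k < n, (∀ j ≤ k, ‖z j‖ ≤ R) → ‖z (k + 1)‖ ≤ R' ∧
      ∃ e : E × E, ‖e‖ ≤ 1 ∧ z (k + 1) = z k + (2 * h) • (S.field (z k) + e) := by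
  obtain ⟨R', hR', h₁, hh₁, hb⟩ := S.exists_implicit_bound R
  obtain ⟨L, hL, hLl, hLb⟩ := S.exists_lipschitz R'
  refine ⟨R' + 4 * L, by linarith, min 1 (min h₁ (1 / L ^ 2)), by positivity, ?_⟩
  intro h h0 hh n z hz k hk hzb
  have hh1 : h ≤ 1 := hh.trans (min_le_left _ _)
  have hh2 : h ≤ h₁ := hh.trans ((min_le_right _ _).trans (min_le_left _ _))
  have hh3 : h * L ^ 2 ≤ 1 := by
    have := hh.trans ((min_le_right _ _).trans (min_le_right _ _))
    rwa [le_div_iff₀ (by positivity)] at this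
  -- The error is half the increment of the field over an implicit step, of order `h * L ^ 2`. This
  -- serves both parities: an explicit step extrapolates with the increment over the implicit step
  -- just before it.
  have key : ∀ c d : E × E, ‖c‖ ≤ R → d = c + h • (S.field d + S.field c) →
      ‖d‖ ≤ R' ∧ ‖(1 / 2 : ℝ) • (S.field d - S.field c)‖ ≤ 1 := by
    intro c d hc hd
    have hdR := hb h h0 hh2 c d hc hd
    refine ⟨hdR, ?_⟩
    have h1 : ‖d - c‖ ≤ h * (L + L) := by
      have : d - c = h • (S.field d + S.field c) := by rw [sub_eq_iff_eq_add']; exact hd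
      rw [this, norm_smul, Real.norm_of_nonneg h0.le]
      gcongr
      exact (norm_add_le _ _).trans (add_le_add (hLb d hdR) (hLb c (hc.trans hR')))
    rw [norm_smul]
    calc ‖(1 / 2 : ℝ)‖ * ‖S.field d - S.field c‖ ≤ 1 / 2 * (L * (h * (L + L))) := by
          gcongr
          · norm_num
          · exact (hLl _ _ hdR (hc.trans hR')).trans (by gcongr)
      _ = h * L ^ 2 := by ring
      _ ≤ 1 := hh3
  rcases Nat.even_or_odd k with hev | hod
  · have hd := (hz k hk).1 hev
    obtain ⟨h1, h2⟩ := key _ _ (hzb k le_rfl) hd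
    refine ⟨by linarith, _, h2, ?_⟩
    conv_lhs => rw [hd]
    module
  · have hd := (hz k hk).2 hod
    obtain ⟨j, rfl⟩ := hod
    have hj : 2 * j + 1 - 1 = 2 * j := by omega
    rw [hj] at hd
    obtain ⟨-, h2⟩ := key _ _ (hzb (2 * j) (by omega)) ((hz (2 * j) (by omega)).1 (by simp))
    refine ⟨?_, _, h2, ?_⟩
    · have h3 := hLb _ ((hzb (2 * j + 1) le_rfl).trans hR')
      have h4 := hLb _ ((hzb (2 * j) (by omega)).trans hR')
      rw [hd]
      calc _ ≤ ‖z (2 * j + 1)‖ + ‖h • ((3 : ℝ) • S.field (z (2 * j + 1)) - S.field (z (2 * j)))‖ :=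
            norm_add_le _ _
        _ ≤ R + 1 * (3 * L + L) := by
          rw [norm_smul, Real.norm_of_nonneg h0.le]
          gcongr
          · exact hzb _ le_rfl
          · refine (norm_sub_le _ _).trans (add_le_add ?_ h4)
            rw [norm_smul]; norm_num; exact h3
        _ ≤ R' + 4 * L := by linarith
    · rw [hd]; module

/-- In the expansion of the square, the cubic term has a favourable sign in the mixed product, and
the part quadratic in `h` is absorbed by the step restriction. Hence `L`, which depends on the ball,
does not enter the growth constants; the bootstrap in `Run.exists_bound` rests on this. -/
theorem norm_sq_euler_step_le {h L : ℝ} (s : E × E) {e : E × E} (he : ‖e‖ ≤ 1) (h0 : 0 ≤ h)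
    (hL : ‖S.field s‖ ≤ L) (hh : h * (4 * (L + 1) ^ 2) ≤ 1) :
    ‖(s + (2 * h) • (S.field s + e)).1‖ ^ 2 ≤
      (1 + 4 * (‖S.b‖ + 1 + (‖S.A₁‖ + ‖S.A₂‖)) * h) * ‖s.1‖ ^ 2 +
        (4 * (‖S.b‖ + 1) + 1) * h := by
  have he1 := (norm_fst_le e).trans he
  obtain ⟨u, v⟩ := s
  set F := S.b - S.A₁ u - S.T u v v + e.1 with hF
  have hFn : ‖F‖ ≤ L + 1 :=
    (norm_fst_le (S.field (u, v) + e)).trans ((norm_add_le _ _).trans (add_le_add hL he))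
  have hin : inner ℝ u F ≤ (‖S.b‖ + 1) * ‖u‖ + (‖S.A₁‖ + ‖S.A₂‖) * ‖u‖ ^ 2 := by
    have e2 : inner ℝ u F = inner ℝ u (S.b + e.1) + inner ℝ u (-S.A₁ u) -
        inner ℝ (S.T u v v) u := by
      rw [real_inner_comm u (S.T u v v), ← inner_add_right, ← inner_sub_right, hF]
      congr 1; abel
    have h2 : inner ℝ u (S.b + e.1) ≤ ‖u‖ * (‖S.b‖ + 1) :=
      (real_inner_le_norm _ _).trans (by gcongr; exact (norm_add_le _ _).trans (by gcongr))
    have h3 : inner ℝ u (-S.A₁ u) ≤ ‖u‖ * ((‖S.A₁‖ + ‖S.A₂‖) * ‖u‖) :=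
      (real_inner_le_norm _ _).trans (by
        rw [norm_neg]; gcongr; exact (S.A₁.le_opNorm _).trans (by gcongr; simp))
    have h4 := S.inner_nonneg u v
    rw [e2]; linarith
  change ‖u + (2 * h) • F‖ ^ 2 ≤ _ * ‖u‖ ^ 2 + _
  rw [norm_add_sq_real, real_inner_smul_right, norm_smul, Real.norm_of_nonneg (by positivity)]
  have h5 : (2 * h * ‖F‖) ^ 2 ≤ h := by
    have h6 : ‖F‖ ^ 2 ≤ (L + 1) ^ 2 := by gcongr
    calc (2 * h * ‖F‖) ^ 2 = h * (h * (4 * ‖F‖ ^ 2)) := by ring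
      _ ≤ h * (h * (4 * (L + 1) ^ 2)) := by gcongr
      _ ≤ h * 1 := by gcongr
      _ = h := mul_one h
  have h7 : ‖u‖ ≤ ‖u‖ ^ 2 + 1 := by nlinarith [sq_nonneg (‖u‖ - 1)]
  have h8 : (‖S.b‖ + 1) * ‖u‖ ≤ (‖S.b‖ + 1) * (‖u‖ ^ 2 + 1) := by gcongr
  have h9 := mul_le_mul_of_nonneg_left (hin.trans (add_le_add_left h8 _)) h0
  linarith

/-- Runs on a bounded time interval are bounded, uniformly in small steps. -/
theorem Run.exists_bound (R T : ℝ) : ∃ R', 0 ≤ R' ∧ ∃ h₀ > 0, ∀ h, 0 < h → h ≤ h₀ → ∀ n : ℕ,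
    n * h ≤ T → ∀ z, S.Run h n z → ‖z 0‖ ≤ R → ∀ k ≤ n, ‖z k‖ ≤ R' := by
  rcases lt_or_ge R 0 with hR | hR
  · exact ⟨0, le_rfl, 1, one_pos, fun h _ _ n _ z _ h0 => by linarith [norm_nonneg (z 0)]⟩
  rcases lt_or_ge T 0 with hT | hT
  · exact ⟨0, le_rfl, 1, one_pos, fun h h0 _ n hn => absurd hn (by
      have : 0 ≤ n * h := by positivity
      linarith)⟩
  set a := ‖S.A₁‖ + ‖S.A₂‖ with ha
  have ha0 : 0 ≤ a := by positivity
  set β := ‖S.b‖ + 1 with hβ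
  have hβ0 : 0 ≤ β := by positivity
  -- `U` bounds `‖u‖` and `W` bounds `‖u + v‖`. They come from Gronwall alone and are fixed before
  -- the Lipschitz constant of the ball of radius `U + W`, so there is no circularity. The summand 1
  -- in `U` replaces a square root, since `2‖u‖ ≤ ‖u‖² + 1`.
  set U := Real.exp ((4 * (β + a)) * T) * (R ^ 2 + (4 * β + 1) * T) + 1 with hU
  have hU0 : 0 ≤ U := by positivity
  set W := Real.exp ((2 * a) * T) * (2 * R + (2 * (β + 1 + 2 * a * U)) * T) with hW
  have hW0 : 0 ≤ W := by positivity
  obtain ⟨R', hR', h₁, hh₁, hst⟩ := Run.exists_euler_step S (U + W)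
  obtain ⟨L, hL, -, hLb⟩ := S.exists_lipschitz (U + W)
  refine ⟨U + W, by positivity, min h₁ (1 / (4 * (L + 1) ^ 2)), by positivity, ?_⟩
  intro h h0 hh n hn z hz hz0 k
  have hh2 : h ≤ h₁ := hh.trans (min_le_left _ _)
  have hh3 : h * (4 * (L + 1) ^ 2) ≤ 1 := by
    have := hh.trans (min_le_right _ _)
    rwa [le_div_iff₀ (by positivity)] at this
  induction k using Nat.strong_induction_on with
  | _ k ih =>
  intro hkn
  have hkT : k * h ≤ T := le_trans (by gcongr) hn
  -- The induction hypothesis keeps the earlier values in the ball, so all steps leading to time `k`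
  -- are perturbed Euler steps.
  have hstep : ∀ j < k, ∃ e : E × E, ‖e‖ ≤ 1 ∧ z (j + 1) = z j + (2 * h) • (S.field (z j) + e) :=
    fun j hj => (hst h h0 hh2 n z hz j (by omega) fun i hi => ih i (by omega) (by omega)).2
  have hu2 : ∀ j ≤ k, ‖(z j).1‖ ≤ U := by
    intro j hj
    have hjT : j * h ≤ T := le_trans (by gcongr) hkT
    have h1 := le_exp_mul_of_step_le (x := fun i => ‖(z i).1‖ ^ 2) (a := 4 * (β + a))
      (b := 4 * β + 1) (c := R ^ 2) (h := h) (n := j) (by positivity) (by positivity) h0.le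
      (by have := (norm_fst_le (z 0)).trans hz0; gcongr) (by positivity) (by
        intro i hi
        obtain ⟨e, he, hze⟩ := hstep i (by omega)
        have hzi := ih i (by omega) (by omega)
        change ‖(z (i + 1)).1‖ ^ 2 ≤ (1 + 4 * (β + a) * h) * ‖(z i).1‖ ^ 2 + (4 * β + 1) * h
        rw [hze]
        exact S.norm_sq_euler_step_le (z i) he h0.le (hLb _ hzi) hh3)
    have h2 : Real.exp ((4 * (β + a)) * (j * h)) * (R ^ 2 + (4 * β + 1) * (j * h)) ≤
        Real.exp ((4 * (β + a)) * T) * (R ^ 2 + (4 * β + 1) * T) := by gcongr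
    have h3 : ‖(z j).1‖ ^ 2 ≤ U - 1 := by rw [hU]; linarith [h1, h2]
    nlinarith [sq_nonneg (‖(z j).1‖ - 1)]
  have hw : ‖(z k).1 + (z k).2‖ ≤ W := by
    have h1 := le_exp_mul_of_step_le (x := fun i => ‖(z i).1 + (z i).2‖) (a := 2 * a)
      (b := 2 * (β + 1 + 2 * a * U)) (c := 2 * R) (h := h) (n := k) (by positivity) (by positivity)
      h0.le (by
        have h2 := (norm_fst_le (z 0)).trans hz0
        have h3 := (norm_snd_le (z 0)).trans hz0
        exact (norm_add_le _ _).trans (by linarith)) (by positivity) (by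
        intro i hi
        obtain ⟨e, he, hze⟩ := hstep i hi
        have he1 := (norm_fst_le e).trans he
        have he2 := (norm_snd_le e).trans he
        have hui := hu2 i hi.le
        set u := (z i).1
        set v := (z i).2
        -- No cubic term is left: what remains is linear in `u + v` and in `u`, and the latter is
        -- already bounded by `U`.
        have e1 : (z (i + 1)).1 + (z (i + 1)).2 =
            u + v + (2 * h) • (S.b - S.A₁ u - S.A₂ v + (e.1 + e.2)) := by
          have e2 : (z (i + 1)).1 = u + (2 * h) • (S.b - S.A₁ u - S.T u v v + e.1) := by
            rw [hze]; rfl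
          have e3 : (z (i + 1)).2 = v + (2 * h) • (S.T u v v - S.A₂ v + e.2) := by
            rw [hze]; rfl
          rw [e2, e3]; module
        have hvn : ‖v‖ ≤ ‖u + v‖ + ‖u‖ := by simpa using norm_sub_le (u + v) u
        have hA1 : ‖S.A₁ u‖ ≤ a * ‖u‖ := (S.A₁.le_opNorm _).trans (by gcongr; simp [ha])
        have hA2 : ‖S.A₂ v‖ ≤ a * ‖v‖ := (S.A₂.le_opNorm _).trans (by gcongr; simp [ha])
        have h2 : ‖S.b - S.A₁ u - S.A₂ v + (e.1 + e.2)‖ ≤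
            ‖S.b‖ + a * ‖u‖ + a * ‖v‖ + (1 + 1) :=
          (norm_add_le _ _).trans (add_le_add ((norm_sub_le _ _).trans
            (add_le_add ((norm_sub_le _ _).trans (by gcongr)) hA2))
            ((norm_add_le _ _).trans (by gcongr)))
        have h3 : a * ‖v‖ ≤ a * (‖u + v‖ + U) := by gcongr; linarith
        have h4 : a * ‖u‖ ≤ a * U := by gcongr
        have h5 : ‖S.b - S.A₁ u - S.A₂ v + (e.1 + e.2)‖ ≤
            a * ‖u + v‖ + (β + 1 + 2 * a * U) := by
          rw [hβ]; linarith
        change ‖(z (i + 1)).1 + (z (i + 1)).2‖ ≤ (1 + 2 * a * h) * ‖u + v‖ +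
          2 * (β + 1 + 2 * a * U) * h
        rw [e1]
        calc _ ≤ ‖u + v‖ + ‖(2 * h) • (S.b - S.A₁ u - S.A₂ v + (e.1 + e.2))‖ := norm_add_le _ _
          _ ≤ ‖u + v‖ + 2 * h * (a * ‖u + v‖ + (β + 1 + 2 * a * U)) := by
            rw [norm_smul, Real.norm_of_nonneg (by positivity)]; gcongr
          _ = _ := by ring)
    refine h1.trans ?_
    rw [hW]; gcongr
  have huk := hu2 k le_rfl
  have hv : ‖(z k).2‖ ≤ ‖(z k).1 + (z k).2‖ + ‖(z k).1‖ := by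
    simpa using norm_sub_le ((z k).1 + (z k).2) (z k).1
  exact max_le (by linarith) (by linarith)

/-- The a priori bound does not depend on the number of steps, so one threshold for `h` makes the
implicit equation solvable at every step and the run can be extended to the end. -/
theorem exists_run [CompleteSpace E] (R T : ℝ) : ∃ h₀ > 0, ∀ h, 0 < h → h ≤ h₀ → ∀ n : ℕ,
    n * h ≤ T → ∀ c : E × E, ‖c‖ ≤ R → ∃ z, S.Run h n z ∧ z 0 = c := by
  obtain ⟨R', -, h₁, hh₁, hb⟩ := Run.exists_bound S R T
  obtain ⟨h₂, hh₂, hs⟩ := S.exists_implicit_step R'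
  refine ⟨min h₁ h₂, by positivity, fun h h0 hh n => ?_⟩
  have hl1 := hh.trans (min_le_left _ _)
  have hl2 := hh.trans (min_le_right _ _)
  induction n with
  | zero => exact fun _ c _ => ⟨fun _ => c, fun k hk => by omega, rfl⟩
  | succ n ih =>
    intro hn c hc
    have hn' : n * h ≤ T := le_trans (by gcongr; omega) hn
    obtain ⟨z, hz, rfl⟩ := ih hn' c hc
    have hzn := hb h h0 hl1 n hn' z hz hc n le_rfl
    obtain ⟨d, hd⟩ : ∃ d, (Even n → d = z n + h • (S.field d + S.field (z n))) ∧
        (Odd n → d = z n + h • ((3 : ℝ) • S.field (z n) - S.field (z (n - 1)))) := by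
      rcases Nat.even_or_odd n with hev | hod
      · obtain ⟨d, hd⟩ := hs h h0 hl2 (z n) hzn
        exact ⟨d, fun _ => hd, fun ho => absurd hev (Nat.not_even_iff_odd.2 ho)⟩
      · exact ⟨_, fun he => absurd he (Nat.not_even_iff_odd.2 hod), fun _ => rfl⟩
    have hne : ∀ k ≤ n, Function.update z (n + 1) d k = z k := fun k hk =>
      Function.update_of_ne (by omega) _ _
    refine ⟨Function.update z (n + 1) d, fun k hk => ?_, hne 0 (by omega)⟩
    rcases (Nat.lt_succ_iff.1 hk).lt_or_eq with hlt | rfl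
    · rw [hne k hlt.le, hne (k + 1) hlt, hne (k - 1) (by omega)]
      exact hz k hlt
    · rw [hne k le_rfl, hne (k - 1) (by omega), Function.update_self]
      exact hd

/-- Runs depend on their starting value in a Lipschitz way, uniformly in small steps. -/
theorem Run.exists_dependence (R T : ℝ) : ∃ C ≥ 1, ∃ h₀ > 0, ∀ h, 0 < h → h ≤ h₀ → ∀ n : ℕ,
    n * h ≤ T → ∀ z z', S.Run h n z → S.Run h n z' → ‖z 0‖ ≤ R → ‖z' 0‖ ≤ R →
      ∀ k ≤ n, ‖z k - z' k‖ ≤ C * ‖z 0 - z' 0‖ := by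
  obtain ⟨R', -, h₁, hh₁, hb⟩ := Run.exists_bound S R T
  obtain ⟨L, hL, hLl, -⟩ := S.exists_lipschitz R'
  -- With `x = h * L ≤ 1 / 2`, an implicit step amplifies differences by at most `(1 + x) / (1 - x)
  -- ≤ 1 + 6x`, an explicit one by at most `1 + 3x + 3x`.
  refine ⟨Real.exp (6 * L * |T|), Real.one_le_exp (by positivity),
    min h₁ (1 / (2 * L)), by positivity, ?_⟩
  intro h h0 hh n hn z z' hz hz' hz0 hz0' k hk
  have hh1 := hh.trans (min_le_left _ _)
  have hh2 : h * L ≤ 1 / 2 := by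
    have := hh.trans (min_le_right _ _)
    rw [le_div_iff₀ (by positivity)] at this
    linarith
  have hhL : 0 < h * L := by positivity
  have hbz := hb h h0 hh1 n hn z hz hz0
  have hbz' := hb h h0 hh1 n hn z' hz' hz0'
  have hf : ∀ j ≤ n, ‖S.field (z j) - S.field (z' j)‖ ≤ L * ‖z j - z' j‖ := fun j hj =>
    hLl _ _ (hbz j hj) (hbz' j hj)
  have himp : ∀ j < n, Even j → ‖z (j + 1) - z' (j + 1) - (z j - z' j)‖ ≤
      h * L * (‖z (j + 1) - z' (j + 1)‖ + ‖z j - z' j‖) := by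
    intro j hj hev
    have e : z (j + 1) - z' (j + 1) - (z j - z' j) =
        h • ((S.field (z (j + 1)) - S.field (z' (j + 1))) + (S.field (z j) - S.field (z' j))) := by
      have e1 := (hz j hj).1 hev
      have e2 := (hz' j hj).1 hev
      rw [← sub_eq_iff_eq_add'] at e1 e2
      rw [sub_sub_sub_comm, e1, e2]; module
    rw [e, norm_smul, Real.norm_of_nonneg h0.le, mul_assoc, mul_add]
    gcongr
    exact (norm_add_le _ _).trans (add_le_add (hf _ hj) (hf _ hj.le))
  have hstep : ∀ j < k, ‖z (j + 1) - z' (j + 1)‖ ≤ (1 + 6 * L * h) * ‖z j - z' j‖ + 0 * h := by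
    intro j hj
    have hp := norm_nonneg (z j - z' j)
    have hp' := norm_nonneg (z (j + 1) - z' (j + 1))
    rcases Nat.even_or_odd j with hev | hod
    · have h1 := himp j (by omega) hev
      have h2 := norm_sub_norm_le (z (j + 1) - z' (j + 1)) (z j - z' j)
      have h3 : (1 - h * L) * ‖z (j + 1) - z' (j + 1)‖ ≤
          (1 - h * L) * ((1 + 6 * L * h) * ‖z j - z' j‖) := by
        have : (1 + h * L) * ‖z j - z' j‖ ≤ (1 - h * L) * (1 + 6 * L * h) * ‖z j - z' j‖ := by
          gcongr
          nlinarith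
        linarith
      have := le_of_mul_le_mul_left h3 (by linarith)
      linarith
    · obtain ⟨i, rfl⟩ := hod
      have hi : 2 * i + 1 - 1 = 2 * i := by omega
      have h1 := himp (2 * i) (by omega) (by simp)
      have h2 := norm_sub_norm_le (z (2 * i) - z' (2 * i)) (z (2 * i + 1) - z' (2 * i + 1))
      rw [norm_sub_rev (z (2 * i) - z' (2 * i))] at h2
      -- The implicit step can be read backwards: the difference one step earlier is at most three
      -- times the present one. The two-step formula thus obeys a one-step recursion, and only the
      -- value at index 0 matters.
      have h3 : ‖z (2 * i) - z' (2 * i)‖ ≤ 3 * ‖z (2 * i + 1) - z' (2 * i + 1)‖ := by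
        have h4 := mul_le_mul_of_nonneg_right hh2
          (add_nonneg hp (norm_nonneg (z (2 * i) - z' (2 * i))))
        linarith
      have e1 := (hz (2 * i + 1) (by omega)).2 (by simp)
      have e2 := (hz' (2 * i + 1) (by omega)).2 (by simp)
      rw [hi] at e1 e2
      have e : z (2 * i + 1 + 1) - z' (2 * i + 1 + 1) = (z (2 * i + 1) - z' (2 * i + 1)) +
          h • ((3 : ℝ) • (S.field (z (2 * i + 1)) - S.field (z' (2 * i + 1))) -
            (S.field (z (2 * i)) - S.field (z' (2 * i)))) := by
        rw [e1, e2]; module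
      have h4 := hf (2 * i + 1) (by omega)
      have h5 := hf (2 * i) (by omega)
      rw [e]
      calc _ ≤ ‖z (2 * i + 1) - z' (2 * i + 1)‖ +
            h * (3 * (L * ‖z (2 * i + 1) - z' (2 * i + 1)‖) +
              L * (3 * ‖z (2 * i + 1) - z' (2 * i + 1)‖)) := by
            refine (norm_add_le _ _).trans ?_
            rw [norm_smul, Real.norm_of_nonneg h0.le]
            gcongr
            refine (norm_sub_le _ _).trans (add_le_add ?_ (h5.trans (by gcongr)))
            rw [norm_smul]
            norm_num
            exact h4
        _ = _ := by ring
  have h1 := le_exp_mul_of_step_le (x := fun j => ‖z j - z' j‖) (a := 6 * L) (b := 0)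
    (c := ‖z 0 - z' 0‖) (h := h) (n := k) (by positivity) le_rfl h0.le le_rfl (norm_nonneg _) hstep
  refine h1.trans ?_
  have h2 : k * h ≤ |T| := le_trans (by gcongr) (hn.trans (le_abs_self T))
  rw [zero_mul, add_zero]
  gcongr

end AutocatalyticSystem

/-! ### The Galerkin system in coordinates -/

section Coordinates

variable {Ω : Set Plane} {M q m : ℕ} {𝒯 : Triangulation Ω M}

theorem continuous_polyEval (p : MvPolynomial (Fin 2) ℝ) : Continuous (polyEval p) := by
  unfold polyEval
  exact (MvPolynomial.continuous_eval p).comp (by fun_prop)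

/-- A polynomial is bounded on a compact triangle, and finitely many triangles cover the domain.
Boundedness is what makes products of four discrete functions integrable. -/
theorem IsPiecewisePoly.exists_ae_bound (hΩ : IsOpen Ω) {z : L2 Ω}
    {p : Fin M → MvPolynomial (Fin 2) ℝ} (hp : IsPiecewisePoly 𝒯 q z p) :
    ∃ C : ℝ, ∀ᵐ x ∂((volume : Measure Plane).restrict Ω), |z x| ≤ C := by
  have h1 : ∀ i, ∃ C, ∀ x ∈ 𝒯.tri i, ‖polyEval (p i) x‖ ≤ C := fun i =>
    ((Set.finite_range (𝒯.vert i)).isCompact_convexHull ℝ).exists_bound_of_continuousOn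
      (continuous_polyEval (p i)).continuousOn
  choose C hC using h1
  refine ⟨∑ i, |C i|, ?_⟩
  filter_upwards [ae_restrict_mem hΩ.measurableSet, ae_all_iff.2 fun i => (hp i).2] with x hx hz
  have hx' : x ∈ ⋃ i, 𝒯.tri i := by
    have := subset_closure hx
    rwa [← 𝒯.cover] at this
  obtain ⟨i, hi⟩ := Set.mem_iUnion.1 hx'
  rw [hz i hi]
  exact (hC i x hi).trans ((le_abs_self _).trans
    (Finset.single_le_sum (f := fun i => |C i|) (fun _ _ => abs_nonneg _) (Finset.mem_univ i)))

/-! ### Coordinates and the cubic form in the spectral basis -/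

namespace SpectralBasis

variable (B : SpectralBasis 𝒯 q m)

theorem mem_femSpace (j : Fin m) : B.φ j ∈ femSpace 𝒯 q := by
  rw [← B.span_eq]
  exact Submodule.subset_span ⟨j, rfl⟩

theorem fn_mem_femSpace (c : Fin m → ℝ) : B.fn c ∈ femSpace 𝒯 q :=
  Submodule.sum_mem _ fun j _ => Submodule.smul_mem _ _ (B.mem_femSpace j)

theorem exists_ae_bound (hΩ : IsOpen Ω) : ∃ C : ℝ, 0 ≤ C ∧
    ∀ᵐ x ∂((volume : Measure Plane).restrict Ω), ∀ j, |B.φ j x| ≤ C := by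
  have h1 : ∀ j, ∃ C : ℝ, ∀ᵐ x ∂((volume : Measure Plane).restrict Ω), |B.φ j x| ≤ C := fun j => by
    obtain ⟨-, p, hp, -⟩ := B.mem_femSpace j
    exact hp.exists_ae_bound hΩ
  choose C hC using h1
  refine ⟨∑ j, |C j|, by positivity, ?_⟩
  filter_upwards [ae_all_iff.2 hC] with x hx j
  exact (hx j).trans ((le_abs_self _).trans
    (Finset.single_le_sum (f := fun i => |C i|) (fun _ _ => abs_nonneg _) (Finset.mem_univ j)))

theorem inner_fn (c d : Fin m → ℝ) : inner ℝ (B.fn c) (B.fn d) = ∑ j, c j * d j := by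
  simpa [fn] using B.orthonormal.inner_sum c d Finset.univ

theorem inner_fn_basis (c : Fin m → ℝ) (j : Fin m) : inner ℝ (B.fn c) (B.φ j) = c j := by
  simpa [fn] using B.orthonormal.inner_left_fintype c j

/-- Parseval: the `L²` norms of the scheme become Euclidean norms of coordinates. -/
theorem norm_fn (c : Fin m → ℝ) : ‖B.fn c‖ = ‖WithLp.toLp 2 c‖ := by
  rw [← sq_eq_sq₀ (norm_nonneg _) (norm_nonneg _), ← real_inner_self_eq_norm_sq, B.inner_fn,
    EuclideanSpace.norm_sq_eq]
  simp [sq]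

theorem fn_sub (c d : Fin m → ℝ) : B.fn (c - d) = B.fn c - B.fn d := by
  simp [fn, sub_smul, Finset.sum_sub_distrib]

/-- The pointwise linear combination of the basis functions with coefficients `c`. -/
noncomputable def eval (c : EuclideanSpace ℝ (Fin m)) (x : Plane) : ℝ := ∑ l, c l * B.φ l x

theorem eval_add (c d : EuclideanSpace ℝ (Fin m)) (x : Plane) :
    B.eval (c + d) x = B.eval c x + B.eval d x := by
  simp [eval, add_mul, Finset.sum_add_distrib]

theorem eval_sub (c d : EuclideanSpace ℝ (Fin m)) (x : Plane) :
    B.eval (c - d) x = B.eval c x - B.eval d x := by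
  simp [eval, sub_mul, Finset.sum_sub_distrib]

theorem eval_single (j : Fin m) (x : Plane) :
    B.eval (EuclideanSpace.single j 1) x = B.φ j x := by
  simp [eval]

theorem fn_ae_eq (c : Fin m → ℝ) :
    B.fn c =ᵐ[(volume : Measure Plane).restrict Ω] B.eval (WithLp.toLp 2 c) := by
  have h1 : ∀ l, ∀ᵐ x ∂((volume : Measure Plane).restrict Ω),
      (c l • B.φ l : L2 Ω) x = c l * B.φ l x := fun l => by
    filter_upwards [Lp.coeFn_smul (c l) (B.φ l)] with x hx
    rw [hx, Pi.smul_apply, smul_eq_mul]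
  filter_upwards [Lp.coeFn_finsetSum Finset.univ fun l => c l • B.φ l, ae_all_iff.2 h1] with x hx h2
  rw [fn, hx, Finset.sum_apply]
  exact Finset.sum_congr rfl fun l _ => h2 l

theorem aestronglyMeasurable_eval (c : EuclideanSpace ℝ (Fin m)) :
    AEStronglyMeasurable (B.eval c) ((volume : Measure Plane).restrict Ω) :=
  (Lp.aestronglyMeasurable (B.fn c.ofLp)).congr (B.fn_ae_eq c.ofLp)

theorem exists_ae_bound_eval (hΩ : IsOpen Ω) : ∃ C : ℝ, 0 ≤ C ∧
    ∀ c, ∀ᵐ x ∂((volume : Measure Plane).restrict Ω), |B.eval c x| ≤ C * ‖c‖ := by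
  obtain ⟨C, hC, hb⟩ := B.exists_ae_bound hΩ
  refine ⟨m * C, by positivity, fun c => ?_⟩
  filter_upwards [hb] with x hx
  calc |B.eval c x| ≤ ∑ l, |c l * B.φ l x| := Finset.abs_sum_le_sum_abs _ _
    _ ≤ ∑ _l : Fin m, ‖c‖ * C := by
      refine Finset.sum_le_sum fun l _ => ?_
      rw [abs_mul]
      exact mul_le_mul (PiLp.norm_apply_le c l) (hx l) (abs_nonneg _) (norm_nonneg _)
    _ = m * C * ‖c‖ := by simp; ring

theorem integrable_eval_mul (hΩ : IsOpen Ω) (hb : Bornology.IsBounded Ω)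
    (u v w z : EuclideanSpace ℝ (Fin m)) :
    Integrable (fun x => B.eval u x * B.eval v x * B.eval w x * B.eval z x)
      ((volume : Measure Plane).restrict Ω) := by
  have : IsFiniteMeasure ((volume : Measure Plane).restrict Ω) :=
    isFiniteMeasure_restrict.2 hb.measure_lt_top.ne
  obtain ⟨C, hC, hbd⟩ := B.exists_ae_bound_eval hΩ
  refine Integrable.of_bound ((((B.aestronglyMeasurable_eval u).mul
    (B.aestronglyMeasurable_eval v)).mul (B.aestronglyMeasurable_eval w)).mul
    (B.aestronglyMeasurable_eval z)) (C * ‖u‖ * (C * ‖v‖) * (C * ‖w‖) * (C * ‖z‖)) ?_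
  filter_upwards [hbd u, hbd v, hbd w, hbd z] with x h1 h2 h3 h4
  simp only [norm_mul, Real.norm_eq_abs]
  gcongr

/-- The vector of the integrals `∫_Ω u v w φ_j`. -/
noncomputable def cubic (u v w : EuclideanSpace ℝ (Fin m)) : EuclideanSpace ℝ (Fin m) :=
  WithLp.toLp 2 fun j => ∫ x in Ω, B.eval u x * B.eval v x * B.eval w x * B.φ j x

theorem cubic_apply (u v w : EuclideanSpace ℝ (Fin m)) (j : Fin m) :
    B.cubic u v w j = ∫ x in Ω, B.eval u x * B.eval v x * B.eval w x * B.φ j x := rfl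

theorem integrable_eval_mul_basis (hΩ : IsOpen Ω) (hb : Bornology.IsBounded Ω)
    (u v w : EuclideanSpace ℝ (Fin m)) (j : Fin m) :
    Integrable (fun x => B.eval u x * B.eval v x * B.eval w x * B.φ j x)
      ((volume : Measure Plane).restrict Ω) := by
  simpa only [eval_single] using B.integrable_eval_mul hΩ hb u v w (EuclideanSpace.single j 1)

theorem inner_cubic (hΩ : IsOpen Ω) (hb : Bornology.IsBounded Ω)
    (u v w z : EuclideanSpace ℝ (Fin m)) : inner ℝ (B.cubic u v w) z =
      ∫ x in Ω, B.eval u x * B.eval v x * B.eval w x * B.eval z x := by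
  have h1 : ∀ x, B.eval u x * B.eval v x * B.eval w x * B.eval z x =
      ∑ j, z j * (B.eval u x * B.eval v x * B.eval w x * B.φ j x) := fun x => by
    conv_lhs => rw [eval.eq_1 B z, Finset.mul_sum]
    exact Finset.sum_congr rfl fun j _ => by ring
  simp_rw [h1]
  rw [integral_finsetSum _ fun j _ => (B.integrable_eval_mul_basis hΩ hb u v w j).const_mul _,
    PiLp.inner_apply]
  refine Finset.sum_congr rfl fun j _ => ?_
  rw [integral_const_mul, ← cubic_apply]
  simp

theorem integral_eval_mul_eval (c d : EuclideanSpace ℝ (Fin m)) :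
    ∫ x in Ω, B.eval c x * B.eval d x = ∑ j, c j * d j := by
  rw [← B.inner_fn, L2.inner_def]
  refine integral_congr_ae ?_
  filter_upwards [B.fn_ae_eq c.ofLp, B.fn_ae_eq d.ofLp] with x h1 h2
  rw [h1, h2]
  simp [mul_comm]

theorem integrable_eval_mul_eval (c d : EuclideanSpace ℝ (Fin m)) :
    Integrable (fun x => B.eval c x * B.eval d x) ((volume : Measure Plane).restrict Ω) :=
  ((Lp.memLp (B.fn c.ofLp)).ae_eq (B.fn_ae_eq c.ofLp)).integrable_mul
    ((Lp.memLp (B.fn d.ofLp)).ae_eq (B.fn_ae_eq d.ofLp))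

/-- Duality: pairing the vector with itself gives an integral of four bounded factors, and one
factor of its norm cancels. -/
theorem norm_cubic_le (hΩ : IsOpen Ω) (hb : Bornology.IsBounded Ω) : ∃ K : ℝ, 0 ≤ K ∧
    ∀ u v w, ‖B.cubic u v w‖ ≤ K * ‖u‖ * ‖v‖ * ‖w‖ := by
  have : IsFiniteMeasure ((volume : Measure Plane).restrict Ω) :=
    isFiniteMeasure_restrict.2 hb.measure_lt_top.ne
  obtain ⟨C, hC, hbd⟩ := B.exists_ae_bound_eval hΩ
  refine ⟨C ^ 4 * ((volume : Measure Plane).restrict Ω).real Set.univ, by positivity,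
    fun u v w => ?_⟩
  set z := B.cubic u v w with hz
  have h1 : ‖z‖ * ‖z‖ ≤ C * ‖u‖ * (C * ‖v‖) * (C * ‖w‖) * (C * ‖z‖) *
      ((volume : Measure Plane).restrict Ω).real Set.univ := by
    rw [← real_inner_self_eq_norm_mul_norm]
    conv_lhs => rw [hz, ← hz, B.inner_cubic hΩ hb]
    refine (Real.le_norm_self _).trans (norm_integral_le_of_norm_le_const ?_)
    filter_upwards [hbd u, hbd v, hbd w, hbd z] with x h1 h2 h3 h4
    simp only [norm_mul, Real.norm_eq_abs]
    gcongr
  rcases (norm_nonneg z).eq_or_lt with h0 | h0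
  · rw [← h0]; positivity
  · refine le_of_mul_le_mul_right (h1.trans_eq ?_) h0
    ring

/-- This is `(∫ v²)² ≤ |Ω| ∫ v⁴`, obtained from `∫ (v² - t)² ≥ 0`. Using `|Ω| + 1` in the choice of
`t` makes the division safe and costs only part of the constant. -/
theorem le_inner_cubic (hΩ : IsOpen Ω) (hb : Bornology.IsBounded Ω)
    (v : EuclideanSpace ℝ (Fin m)) :
    1 / (((volume : Measure Plane).restrict Ω).real Set.univ + 1) * ‖v‖ ^ 4 ≤
      inner ℝ (B.cubic v v v) v := by
  have : IsFiniteMeasure ((volume : Measure Plane).restrict Ω) :=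
    isFiniteMeasure_restrict.2 hb.measure_lt_top.ne
  set V := ((volume : Measure Plane).restrict Ω).real Set.univ with hV
  have hV0 : 0 ≤ V := measureReal_nonneg
  set t := ‖v‖ ^ 2 / (V + 1) with ht
  have h1 : 0 ≤ ∫ x in Ω, (B.eval v x * B.eval v x - t) ^ 2 :=
    integral_nonneg fun x => sq_nonneg _
  have h2 : ∫ x in Ω, (B.eval v x * B.eval v x - t) ^ 2 =
      inner ℝ (B.cubic v v v) v - 2 * t * ‖v‖ ^ 2 + t ^ 2 * V := by
    have e : ∀ x, (B.eval v x * B.eval v x - t) ^ 2 =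
        B.eval v x * B.eval v x * B.eval v x * B.eval v x -
          2 * t * (B.eval v x * B.eval v x) + t ^ 2 := fun x => by ring
    simp_rw [e]
    have hi1 := B.integrable_eval_mul hΩ hb v v v v
    have hi2 := (B.integrable_eval_mul_eval v v).const_mul (2 * t)
    have hi3 : Integrable (fun x => B.eval v x * B.eval v x * B.eval v x * B.eval v x -
        2 * t * (B.eval v x * B.eval v x)) ((volume : Measure Plane).restrict Ω) := hi1.sub hi2
    rw [integral_add hi3 (integrable_const _), integral_sub hi1 hi2, integral_const_mul,
      B.integral_eval_mul_eval, B.inner_cubic hΩ hb, EuclideanSpace.norm_sq_eq, integral_const]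
    simp [sq, hV, mul_comm]
  have h3 : t * (V + 1) = ‖v‖ ^ 2 := div_mul_cancel₀ _ (by positivity)
  have h4 : 1 / (V + 1) * ‖v‖ ^ 4 = t * ‖v‖ ^ 2 := by rw [ht]; ring
  rw [h4]
  nlinarith [sq_nonneg t]

/-- The diagonal operator with the coefficients `d`. -/
noncomputable def diag (d : Fin m → ℝ) : EuclideanSpace ℝ (Fin m) →L[ℝ] EuclideanSpace ℝ (Fin m) :=
  LinearMap.toContinuousLinearMap
    { toFun := fun u => WithLp.toLp 2 fun j => d j * u j
      map_add' := fun u v => by ext j; simp [mul_add]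
      map_smul' := fun c u => by ext j; simp; ring }

theorem diag_apply (d : Fin m → ℝ) (u : EuclideanSpace ℝ (Fin m)) (j : Fin m) :
    diag d u j = d j * u j := rfl

theorem integrable_basis (hb : Bornology.IsBounded Ω) (j : Fin m) :
    Integrable (B.φ j) ((volume : Measure Plane).restrict Ω) := by
  have : IsFiniteMeasure ((volume : Measure Plane).restrict Ω) :=
    isFiniteMeasure_restrict.2 hb.measure_lt_top.ne
  exact (Lp.memLp (B.φ j)).integrable (by norm_num)

theorem integral_eval_mul_basis (c : EuclideanSpace ℝ (Fin m)) (j : Fin m) :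
    ∫ x in Ω, B.eval c x * B.φ j x = c j := by
  have := B.integral_eval_mul_eval c (EuclideanSpace.single j 1)
  simpa [eval_single, Pi.single_apply] using this

theorem integrable_eval_mul_basis' (c : EuclideanSpace ℝ (Fin m)) (j : Fin m) :
    Integrable (fun x => B.eval c x * B.φ j x) ((volume : Measure Plane).restrict Ω) := by
  simpa only [eval_single] using B.integrable_eval_mul_eval c (EuclideanSpace.single j 1)

end SpectralBasis

/-! ### The Galerkin field and the two stages -/

variable (P : Params) (B : SpectralBasis 𝒯 q m)

theorem load₁_eq (hΩ : IsOpen Ω) (hb : Bornology.IsBounded Ω) (s : State m) (j : Fin m) :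
    load₁ P B s j = P.β₀ * (∫ x in Ω, B.φ j x) - P.β₀ * s.1 j -
      B.cubic (WithLp.toLp 2 s.1) (WithLp.toLp 2 s.2) (WithLp.toLp 2 s.2) j := by
  set u := WithLp.toLp 2 s.1
  set v := WithLp.toLp 2 s.2
  have h1 : load₁ P B s j = ∫ x in Ω, (P.β₀ * B.φ j x - P.β₀ * (B.eval u x * B.φ j x) -
      B.eval u x * B.eval v x * B.eval v x * B.φ j x) := by
    refine integral_congr_ae ?_
    filter_upwards [B.fn_ae_eq s.1, B.fn_ae_eq s.2] with x h1 h2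
    rw [h1, h2, Params.F₁]; ring
  have hi1 := (B.integrable_basis hb j).const_mul P.β₀
  have hi2 := (B.integrable_eval_mul_basis' u j).const_mul P.β₀
  have hi3 : Integrable (fun x => P.β₀ * B.φ j x - P.β₀ * (B.eval u x * B.φ j x))
      ((volume : Measure Plane).restrict Ω) := hi1.sub hi2
  rw [h1, integral_sub hi3 (B.integrable_eval_mul_basis hΩ hb u v v j),
    integral_sub hi1 hi2, integral_const_mul, integral_const_mul, B.integral_eval_mul_basis,
    B.cubic_apply]

theorem load₂_eq (hΩ : IsOpen Ω) (hb : Bornology.IsBounded Ω) (s : State m) (j : Fin m) :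
    load₂ P B s j =
      B.cubic (WithLp.toLp 2 s.1) (WithLp.toLp 2 s.2) (WithLp.toLp 2 s.2) j -
        (P.β₀ + P.k₀) * s.2 j := by
  set u := WithLp.toLp 2 s.1
  set v := WithLp.toLp 2 s.2
  have h1 : load₂ P B s j = ∫ x in Ω, (B.eval u x * B.eval v x * B.eval v x * B.φ j x -
      (P.β₀ + P.k₀) * (B.eval v x * B.φ j x)) := by
    refine integral_congr_ae ?_
    filter_upwards [B.fn_ae_eq s.1, B.fn_ae_eq s.2] with x h1 h2
    rw [h1, h2, Params.F₂]; ring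
  rw [h1, integral_sub (B.integrable_eval_mul_basis hΩ hb u v v j)
    ((B.integrable_eval_mul_basis' v j).const_mul _), integral_const_mul,
    B.integral_eval_mul_basis, B.cubic_apply]

/-- The coordinates of a state as a pair of vectors in Euclidean space. -/
def stateEquiv (m : ℕ) :
    State m ≃ₗ[ℝ] EuclideanSpace ℝ (Fin m) × EuclideanSpace ℝ (Fin m) :=
  LinearEquiv.prodCongr (WithLp.linearEquiv 2 ℝ (Fin m → ℝ)).symm
    (WithLp.linearEquiv 2 ℝ (Fin m → ℝ)).symm

theorem stateEquiv_apply (s : State m) :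
    stateEquiv m s = (WithLp.toLp 2 s.1, WithLp.toLp 2 s.2) := rfl

/-- The Galerkin system is an autocatalytic system. -/
theorem exists_autocatalyticSystem (hΩ : IsOpen Ω) (hb : Bornology.IsBounded Ω) :
    ∃ S : AutocatalyticSystem (EuclideanSpace ℝ (Fin m)),
      ∀ s, S.field (stateEquiv m s) = stateEquiv m (galerkinField P B s) := by
  obtain ⟨K, hK, hKb⟩ := B.norm_cubic_le hΩ hb
  refine ⟨{
    -- Diffusion and the linear reaction are diagonal in the spectral basis; the constant part of
    -- the feed term becomes `b`.
    A₁ := SpectralBasis.diag fun j => P.α₁ * B.ev j + P.β₀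
    A₂ := SpectralBasis.diag fun j => P.α₂ * B.ev j + (P.β₀ + P.k₀)
    b := WithLp.toLp 2 fun j => P.β₀ * ∫ x in Ω, B.φ j x
    T := B.cubic
    K := K
    κ := 1 / (((volume : Measure Plane).restrict Ω).real Set.univ + 1)
    K_nonneg := hK
    κ_pos := by positivity
    sub_left := fun u u' v w => ?_
    sq_sub := fun u v v' => ?_
    norm_le := hKb
    inner_nonneg := fun u v => ?_
    coercive := B.le_inner_cubic hΩ hb }, fun s => ?_⟩
  · ext j
    rw [PiLp.sub_apply, B.cubic_apply, B.cubic_apply, B.cubic_apply,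
      ← integral_sub (B.integrable_eval_mul_basis hΩ hb u v w j)
        (B.integrable_eval_mul_basis hΩ hb u' v w j)]
    refine integral_congr_ae (.of_forall fun x => ?_)
    simp only [B.eval_sub]; ring
  · ext j
    rw [PiLp.sub_apply, B.cubic_apply, B.cubic_apply, B.cubic_apply,
      ← integral_sub (B.integrable_eval_mul_basis hΩ hb u v v j)
        (B.integrable_eval_mul_basis hΩ hb u v' v' j)]
    refine integral_congr_ae (.of_forall fun x => ?_)
    simp only [B.eval_sub, B.eval_add]; ring
  · rw [B.inner_cubic hΩ hb]
    refine integral_nonneg fun x => ?_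
    have : B.eval u x * B.eval v x * B.eval v x * B.eval u x = (B.eval u x * B.eval v x) ^ 2 := by
      ring
    simp only [this]
    positivity
  · refine Prod.ext ?_ ?_ <;> ext j
    · simp only [AutocatalyticSystem.field, stateEquiv_apply, galerkinField, PiLp.sub_apply,
        SpectralBasis.diag_apply, load₁_eq P B hΩ hb]
      ring
    · simp only [AutocatalyticSystem.field, stateEquiv_apply, galerkinField, PiLp.sub_apply,
        SpectralBasis.diag_apply, load₂_eq P B hΩ hb]
      ring

theorem firstStage_iff (σ : ℝ) (a b c : State m) : FirstStage P B σ a b c ↔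
    c = b + (σ / 4) • ((3 : ℝ) • galerkinField P B b - galerkinField P B a) := by
  simp only [FirstStage, Prod.ext_iff, funext_iff, forall_and, galerkinField, Prod.fst_add,
    Prod.snd_add, Prod.smul_fst, Prod.smul_snd, Prod.fst_sub, Prod.snd_sub, Pi.add_apply,
    Pi.smul_apply, Pi.sub_apply, smul_eq_mul]
  refine and_congr (forall_congr' fun j => ?_) (forall_congr' fun j => ?_) <;>
    constructor <;> intro h <;> linarith

theorem secondStage_iff (σ : ℝ) (c d : State m) : SecondStage P B σ c d ↔
    d = c + (σ / 4) • (galerkinField P B d + galerkinField P B c) := by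
  simp only [SecondStage, Prod.ext_iff, funext_iff, forall_and, galerkinField, Prod.fst_add,
    Prod.snd_add, Prod.smul_fst, Prod.smul_snd, Pi.add_apply, Pi.smul_apply, smul_eq_mul]
  refine and_congr (forall_congr' fun j => ?_) (forall_congr' fun j => ?_) <;>
    constructor <;> intro h <;> linarith

theorem firstStage_iff_step (σ : ℝ) (z : Fin 3 → State m) :
    FirstStage P B σ (z 0) (z 1) (z 2) ↔
      explicitFormula.Step (σ / 2) (galerkinField P B) z := by
  rw [firstStage_iff, LinearMultistep.Step, Fin.sum_univ_three, Fin.sum_univ_three]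
  simp only [explicitFormula, Matrix.cons_val, Matrix.cons_val_zero, Matrix.cons_val_one]
  -- Both equations become the vanishing of the same difference, because `σ / 2` times the weights
  -- `3 / 2`, `-1 / 2` is `σ / 4` times `3`, `-1`.
  rw [← sub_eq_zero, ← sub_eq_zero (b := (σ / 2) • _)]
  refine Eq.congr_left ?_
  module

theorem secondStage_iff_step (σ : ℝ) (z : Fin 4 → State m) :
    SecondStage P B σ (z 2) (z 3) ↔ implicitFormula.Step (σ / 2) (galerkinField P B) z := by
  rw [secondStage_iff, LinearMultistep.Step, Fin.sum_univ_four, Fin.sum_univ_four]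
  simp only [implicitFormula, Matrix.cons_val, Matrix.cons_val_zero, Matrix.cons_val_one]
  rw [← sub_eq_zero, ← sub_eq_zero (b := (σ / 2) • _)]
  refine Eq.congr_left ?_
  module

end Coordinates

/-! ### The root condition -/

/-- The roots are 1, which is simple, and 0, which lies inside the disc so that its multiplicity is
irrelevant. -/
theorem LinearMultistep.stronglyStable_of_charPoly {k n : ℕ} (L : LinearMultistep k)
    (hL : L.charPoly = (Polynomial.X - Polynomial.C 1) * Polynomial.X ^ (n + 1)) :
    L.StronglyStable := by
  have hroot : ∀ z : ℂ, L.charPoly.IsRoot z ↔ z = 1 ∨ z = 0 := fun z => by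
    simp [hL, Polynomial.IsRoot, sub_eq_zero]
  have hne : (Polynomial.X - Polynomial.C 1 : Polynomial ℂ) * Polynomial.X ^ (n + 1) ≠ 0 :=
    mul_ne_zero (Polynomial.X_sub_C_ne_zero 1) (pow_ne_zero _ Polynomial.X_ne_zero)
  have hmult : L.charPoly.rootMultiplicity 1 = 1 := by
    rw [hL, Polynomial.rootMultiplicity_mul hne, Polynomial.rootMultiplicity_X_sub_C_self,
      Polynomial.rootMultiplicity_eq_zero (by simp)]
  refine ⟨fun z hz => ?_, fun z => ?_⟩
  · rcases (hroot z).1 hz with rfl | rfl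
    · exact ⟨by simp, fun _ => hmult⟩
    · simp
  · rw [hroot]
    constructor
    · rintro ⟨rfl | rfl, h⟩
      · rfl
      · simp at h
    · rintro rfl
      simp

theorem stronglyStable_explicitFormula : explicitFormula.StronglyStable := by
  refine explicitFormula.stronglyStable_of_charPoly (n := 0) ?_
  rw [LinearMultistep.charPoly, Fin.sum_univ_three]
  simp [explicitFormula]
  ring

theorem stronglyStable_implicitFormula : implicitFormula.StronglyStable := by
  refine implicitFormula.stronglyStable_of_charPoly (n := 1) ?_
  rw [LinearMultistep.charPoly, Fin.sum_univ_four]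
  simp [implicitFormula]
  ring

/-! ### Runs of the scheme -/

section Runs

variable {Ω : Set Plane} {M q m : ℕ} {𝒯 : Triangulation Ω M} {P : Params}
  {B : SpectralBasis 𝒯 q m}

/-- The Neumann condition is built into the space, so this part of the scheme is automatic. -/
theorem SpectralBasis.isNeumann_fn (B : SpectralBasis 𝒯 q m) (c : Fin m → ℝ) :
    IsNeumann 𝒯 q (B.fn c) := by
  obtain ⟨-, p, hp, -, hn⟩ := B.fn_mem_femSpace c
  exact ⟨p, hp, hn⟩

/-- Runs of the scheme are the runs of the autocatalytic system, which start at time `σ / 2`. -/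
theorem isRun_iff {S : AutocatalyticSystem (EuclideanSpace ℝ (Fin m))}
    (hS : ∀ s, S.field (stateEquiv m s) = stateEquiv m (galerkinField P B s)) {σ : ℝ} {N : ℕ}
    {y : ℕ → State m} :
    IsRun P B σ N y ↔ S.Run (σ / 4) (2 * N - 1) fun k => stateEquiv m (y (k + 1)) := by
  have h1 : ∀ a b c, FirstStage P B σ a b c ↔ stateEquiv m c = stateEquiv m b +
      (σ / 4) • ((3 : ℝ) • S.field (stateEquiv m b) - S.field (stateEquiv m a)) := fun a b c => by
    rw [firstStage_iff, hS, hS, ← map_smul, ← map_sub, ← map_smul, ← map_add,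
      (stateEquiv m).injective.eq_iff]
  have h2 : ∀ c d, SecondStage P B σ c d ↔ stateEquiv m d = stateEquiv m c +
      (σ / 4) • (S.field (stateEquiv m d) + S.field (stateEquiv m c)) := fun c d => by
    rw [secondStage_iff, hS, hS, ← map_add, ← map_smul, ← map_add,
      (stateEquiv m).injective.eq_iff]
  -- Index `k` of the system is index `k + 1` of the scheme: even `k = 2n` is the second stage of
  -- step `n`, odd `k = 2n + 1` the first stage of step `n + 1`. From index 1 to index `2 * N` there
  -- are `2 * N - 1` steps.
  constructor
  · intro h k hk
    refine ⟨fun hev => ?_, fun hod => ?_⟩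
    · obtain ⟨n, rfl⟩ := hev.two_dvd
      exact (h2 _ _).1 (h.second n (by omega))
    · obtain ⟨n, rfl⟩ := hod
      exact (h1 _ _ _).1 (h.first (n + 1) (by omega) (by omega))
  · intro h
    refine ⟨fun n hn hnN => ?_, fun n hn => ?_, fun n _ _ => ⟨B.isNeumann_fn _, B.isNeumann_fn _⟩⟩
    · obtain ⟨n, rfl⟩ := Nat.exists_eq_add_of_le' hn
      exact (h1 _ _ _).2 ((h (2 * n + 1) (by omega)).2 (by simp))
    · exact (h2 _ _).2 ((h (2 * n) (by omega)).1 (by simp))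

theorem stateDist_eq (s t : State m) : stateDist B s t =
    ‖(stateEquiv m s - stateEquiv m t).1‖ + ‖(stateEquiv m s - stateEquiv m t).2‖ := by
  rw [stateDist, ← B.fn_sub, ← B.fn_sub, B.norm_fn, B.norm_fn, ← map_sub]
  rfl

theorem norm_sub_le_stateDist (s t : State m) :
    ‖stateEquiv m s - stateEquiv m t‖ ≤ stateDist B s t := by
  rw [stateDist_eq]
  exact max_le_add_of_nonneg (norm_nonneg _) (norm_nonneg _)

theorem stateDist_le (s t : State m) :
    stateDist B s t ≤ 2 * ‖stateEquiv m s - stateEquiv m t‖ := by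
  rw [stateDist_eq, two_mul]
  exact add_le_add (norm_fst_le _) (norm_snd_le _)

theorem stateDist_nonneg (s t : State m) : 0 ≤ stateDist B s t :=
  add_nonneg (norm_nonneg _) (norm_nonneg _)

theorem steps_mul_le {T : ℝ} (hT : 0 < T) {N : ℕ} (hN : 1 ≤ N) :
    ((2 * N - 1 : ℕ) : ℝ) * (T / N / 4) ≤ T := by
  have hN0 : (0 : ℝ) < N := by exact_mod_cast hN
  calc ((2 * N - 1 : ℕ) : ℝ) * (T / N / 4) ≤ ((2 * N : ℕ) : ℝ) * (T / N / 4) := by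
        gcongr; omega
    _ = T / 2 := by push_cast; field_simp; norm_num
    _ ≤ T := by linarith

theorem isStronglyStable (hΩ : IsOpen Ω) (hb : Bornology.IsBounded Ω) (P : Params)
    (B : SpectralBasis 𝒯 q m) {T : ℝ} (hT : 0 < T) : IsStronglyStable P B T := by
  refine ⟨firstStage_iff_step P B, secondStage_iff_step P B, stronglyStable_explicitFormula,
    stronglyStable_implicitFormula, fun R => ?_⟩
  obtain ⟨S, hS⟩ := exists_autocatalyticSystem P B hΩ hb
  obtain ⟨C, hC, h₀, hh₀, hdep⟩ := AutocatalyticSystem.Run.exists_dependence S R T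
  -- The system runs with `h = σ / 4`, and the factor 2 compares the sum of the two norms with their
  -- maximum.
  refine ⟨4 * h₀, by positivity, 2 * C, fun N hN hσ y y' hy hy' hR k hk => ?_⟩
  have hN0 : (0 : ℝ) < N := by exact_mod_cast hN
  have hmax : 0 ≤ max (stateDist B (y 0) (y' 0)) (stateDist B (y 1) (y' 1)) :=
    (stateDist_nonneg _ _).trans (le_max_left _ _)
  have hbd : ∀ s : State m, stateDist B s 0 ≤ R → ‖stateEquiv m s‖ ≤ R := fun s hs => by
    simpa using (norm_sub_le_stateDist (B := B) s 0).trans hs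
  -- The value at time 0 enters no stage, so its difference is covered by the maximum itself; all
  -- later ones are governed by the value at time `σ / 2`.
  rcases k with _ | k
  · exact (le_max_left _ _).trans (le_mul_of_one_le_left hmax (by linarith))
  · have h1 := hdep (T / N / 4) (by positivity) (by linarith) (2 * N - 1) (steps_mul_le hT hN) _ _
      ((isRun_iff hS).1 hy) ((isRun_iff hS).1 hy') (hbd _ (hR 1 le_rfl).1) (hbd _ (hR 1 le_rfl).2)
      k (by omega)
    calc stateDist B (y (k + 1)) (y' (k + 1))
        ≤ 2 * (C * ‖stateEquiv m (y 1) - stateEquiv m (y' 1)‖) :=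
          (stateDist_le _ _).trans (by gcongr)
      _ = 2 * C * ‖stateEquiv m (y 1) - stateEquiv m (y' 1)‖ := by ring
      _ ≤ 2 * C * max (stateDist B (y 0) (y' 0)) (stateDist B (y 1) (y' 1)) := by
          gcongr
          exact (norm_sub_le_stateDist _ _).trans (le_max_right _ _)

theorem IsL2Proj.norm_le {g w : L2 Ω} (h : IsL2Proj 𝒯 q g w) : ‖w‖ ≤ ‖g‖ := by
  have h1 : ‖w‖ * ‖w‖ ≤ ‖g‖ * ‖w‖ := by
    rw [← real_inner_self_eq_norm_mul_norm, h.2 w h.1]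
    exact real_inner_le_norm _ _
  rcases (norm_nonneg w).eq_or_lt with h0 | h0
  · rw [← h0]; exact norm_nonneg g
  · exact le_of_mul_le_mul_right h1 h0

theorem SpectralBasis.isL2Proj_fn (B : SpectralBasis 𝒯 q m) (g : L2 Ω) :
    IsL2Proj 𝒯 q g (B.fn fun j => inner ℝ g (B.φ j)) := by
  refine ⟨B.fn_mem_femSpace _, fun z hz => ?_⟩
  rw [← B.span_eq] at hz
  induction hz using Submodule.span_induction with
  | mem z hz =>
    obtain ⟨j, rfl⟩ := hz
    exact B.inner_fn_basis _ j
  | zero => simp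
  | add x y _ _ hx hy => rw [inner_add_right, inner_add_right, hx, hy]
  | smul c x _ hx => rw [inner_smul_right, inner_smul_right, hx]

theorem norm_stateEquiv_le (B : SpectralBasis 𝒯 q m) (s : State m) {R : ℝ} (h1 : ‖B.fn s.1‖ ≤ R)
    (h2 : ‖B.fn s.2‖ ≤ R) : ‖stateEquiv m s‖ ≤ R := by
  rw [B.norm_fn] at h1 h2
  exact max_le h1 h2

theorem norm_fn_le (B : SpectralBasis 𝒯 q m) (s : State m) :
    ‖B.fn s.1‖ ≤ ‖stateEquiv m s‖ ∧ ‖B.fn s.2‖ ≤ ‖stateEquiv m s‖ := by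
  rw [B.norm_fn, B.norm_fn]
  exact ⟨norm_fst_le (stateEquiv m s), norm_snd_le (stateEquiv m s)⟩

/-- The factor only weakens the bound: it is at least 1 unless the space is trivial, and then the
function is 0. -/
theorem SpectralBasis.norm_fn_le_mul_sqrt (B : SpectralBasis 𝒯 q m) {c : Fin m → ℝ} {C : ℝ}
    (h : ‖B.fn c‖ ≤ C) : ‖B.fn c‖ ≤ C * Real.sqrt m := by
  rcases Nat.eq_zero_or_pos m with rfl | hm
  · simp [SpectralBasis.fn]
  · have : 1 ≤ Real.sqrt m := Real.one_le_sqrt.2 (by exact_mod_cast hm)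
    exact h.trans (le_mul_of_one_le_right ((norm_nonneg _).trans h) this)

theorem exists_solution_and_bound (hΩ : IsOpen Ω) (hb : Bornology.IsBounded Ω) (P : Params)
    (B : SpectralBasis 𝒯 q m) {T : ℝ} (hT : 0 < T) (u₀ v₀ u₁ v₁ : L2 Ω) :
    ∃ σ₀ > 0, ∃ C₀ > 0, ∀ N : ℕ, 1 ≤ N → T / N ≤ σ₀ →
      (∃ y : ℕ → State m, IsNumericalSolution P B u₀ v₀ u₁ v₁ (T / N) N y) ∧
      ∀ y : ℕ → State m, IsNumericalSolution P B u₀ v₀ u₁ v₁ (T / N) N y →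
        ∀ k ≤ 2 * N,
          ‖B.fn (y k).1‖ ≤ C₀ * Real.sqrt m ∧ ‖B.fn (y k).2‖ ≤ C₀ * Real.sqrt m := by
  obtain ⟨S, hS⟩ := exists_autocatalyticSystem P B hΩ hb
  set R := ‖u₀‖ + ‖v₀‖ + T * ‖u₁‖ + T * ‖v₁‖ with hR
  obtain ⟨R', hR', h₁, hh₁, hbd⟩ := AutocatalyticSystem.Run.exists_bound S R T
  obtain ⟨h₂, hh₂, hex⟩ := S.exists_run R T
  -- In the constant, `R` covers time 0, `R'` covers the run from time `σ / 2` on, and 1 ensures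
  -- positivity.
  refine ⟨4 * min h₁ h₂, by positivity, R + R' + 1, by positivity, fun N hN hσ => ?_⟩
  have hN0 : (1 : ℝ) ≤ N := by exact_mod_cast hN
  have hσT : T / N ≤ T := div_le_self hT.le hN0
  have hσ0 : 0 < T / N := by positivity
  have hl1 : T / N / 4 ≤ h₁ := by linarith [min_le_left h₁ h₂]
  have hl2 : T / N / 4 ≤ h₂ := by linarith [min_le_right h₁ h₂]
  have hp1 : 0 ≤ T * ‖u₁‖ := by positivity
  have hp2 : 0 ≤ T * ‖v₁‖ := by positivity
  have hhalf : ∀ w₀ w₁ : L2 Ω, ‖w₀ + (T / N / 2) • w₁‖ ≤ ‖w₀‖ + T * ‖w₁‖ := fun w₀ w₁ => by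
    refine (norm_add_le _ _).trans ?_
    rw [norm_smul, Real.norm_of_nonneg (by positivity)]
    gcongr
    linarith
  have hstart : ∀ s : State m, IsL2Proj 𝒯 q (u₀ + (T / N / 2) • u₁) (B.fn s.1) →
      IsL2Proj 𝒯 q (v₀ + (T / N / 2) • v₁) (B.fn s.2) → ‖stateEquiv m s‖ ≤ R :=
    fun s h1 h2 => norm_stateEquiv_le B s
      ((h1.norm_le.trans (hhalf _ _)).trans (by linarith [norm_nonneg v₀]))
      ((h2.norm_le.trans (hhalf _ _)).trans (by linarith [norm_nonneg u₀]))
  constructor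
  · set s : State m := (fun j => inner ℝ (u₀ + (T / N / 2) • u₁) (B.φ j),
      fun j => inner ℝ (v₀ + (T / N / 2) • v₁) (B.φ j)) with hs
    have hs1 := B.isL2Proj_fn (u₀ + (T / N / 2) • u₁)
    have hs2 := B.isL2Proj_fn (v₀ + (T / N / 2) • v₁)
    obtain ⟨z, hz, hz0⟩ := hex (T / N / 4) (by positivity) hl2 (2 * N - 1) (steps_mul_le hT hN)
      (stateEquiv m s) (hstart s hs1 hs2)
    -- The run of the system starts at time `σ / 2`; the projected data at time 0 are put in front
    -- of it.
    let y : ℕ → State m := fun k => Nat.casesOn k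
      (fun j => inner ℝ u₀ (B.φ j), fun j => inner ℝ v₀ (B.φ j)) fun k => (stateEquiv m).symm (z k)
    have hy1 : y 1 = s := by
      change (stateEquiv m).symm (z 0) = s
      rw [hz0, LinearEquiv.symm_apply_apply]
    refine ⟨y, (isRun_iff hS).2 ?_, B.isL2Proj_fn u₀, B.isL2Proj_fn v₀, ?_, ?_⟩
    · have : (fun k => stateEquiv m (y (k + 1))) = z :=
        funext fun k => (stateEquiv m).apply_symm_apply (z k)
      rwa [this]
    · rw [hy1]; exact hs1
    · rw [hy1]; exact hs2
  · intro y hy k hk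
    have h1 : ‖stateEquiv m (y k)‖ ≤ R + R' + 1 := by
      rcases k with _ | k
      · have := norm_stateEquiv_le B (y 0) (R := R)
          (hy.start_u.norm_le.trans (by linarith [norm_nonneg v₀]))
          (hy.start_v.norm_le.trans (by linarith [norm_nonneg u₀]))
        linarith
      · have := hbd (T / N / 4) (by positivity) hl1 (2 * N - 1) (steps_mul_le hT hN) _
          ((isRun_iff hS).1 hy.run) (hstart _ hy.half_u hy.half_v) k (by omega)
        have hR0 : 0 ≤ R := by positivity
        linarith
    obtain ⟨h2, h3⟩ := norm_fn_le B (y k)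
    exact ⟨B.norm_fn_le_mul_sqrt (h2.trans h1), B.norm_fn_le_mul_sqrt (h3.trans h1)⟩

end Runs

end GrayScottFEM

theorem theorem1
    {Ω : Set Plane} (hΩ_open : IsOpen Ω) (hΩ_conn : IsConnected Ω)
    (hΩ_bdd : Bornology.IsBounded Ω) (hΩ_bdry : interior (closure Ω) = Ω)
    {M : ℕ} (𝒯 : Triangulation Ω M)
    {q : ℕ} (hq : 2 ≤ q) {m : ℕ} (B : SpectralBasis 𝒯 q m)
    (P : Params) {T : ℝ} (hT : 0 < T) (u₀ v₀ u₁ v₁ : L2 Ω) :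
    IsStronglyStable P B T ∧
      ∃ σ₀ > 0, ∃ C₀ > 0, ∀ N : ℕ, 1 ≤ N → T / N ≤ σ₀ →
        (∃ y : ℕ → State m, IsNumericalSolution P B u₀ v₀ u₁ v₁ (T / N) N y) ∧
        ∀ y : ℕ → State m, IsNumericalSolution P B u₀ v₀ u₁ v₁ (T / N) N y →
          ∀ k ≤ 2 * N,
            ‖B.fn (y k).1‖ ≤ C₀ * Real.sqrt m ∧ ‖B.fn (y k).2‖ ≤ C₀ * Real.sqrt m :=
  ⟨isStronglyStable hΩ_open hΩ_bdd P B hT,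
    exists_solution_and_bound hΩ_open hΩ_bdd P B hT u₀ v₀ u₁ v₁⟩
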